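/- Let $d\ge 1$, let $\mathbb M$ be a complete separable metric space with a Borel probability measure $\mathbb Q$, and put $\mathbb X=\mathbb R^d\times\mathbb M$, $\lambda=\lambda_d\otimes\mathbb Q$, where $\lambda_d$ is Lebesgue measure. Let $\varphi\colon\mathbb X^2\to[0,1]$ be measurable, symmetric and translation invariant, that is, $\varphi((x,p),(y,q))=\varphi((0,p),(y-x,q))$. For $t\ge 0$ let $\eta$ be a Poisson process on $\mathbb X$ with intensity measure $t\lambda$. For $v\in\mathbb X$ let $\xi^v$ be the random connection model driven by $\eta+\delta_v$ (any two distinct vertices $z,w$ are joined by an edge with probability $\varphi(z,w)$, independently for different pairs), let $V^v$ be the set of vertices of the component of $v$ in $\xi^v$, and let $c^v(t)=\mathbb E_t|V^v|\in[1,\infty]$. Define $$t_T:=\sup\Big\{t\ge0:\ \operatorname*{ess\,sup}_{v\in\mathbb X}c^v(t)<\infty\Big\},\qquad t_T^{(r)}:=\inf\big\{t\ge 0:\ \|c(t)\|_r=\infty\big\},\quad r\in[1,\infty],$$ where the essential supremum refers to $\lambda$, $\|c(t)\|_r$ is the $L^r(\mathbb Q)$-norm of $p\mapsto c^{(0,p)}(t)$,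 and $\inf\emptyset:=\infty$. For $n\in\mathbb N=\{1,2,\dots\}$ and $p,q\in\mathbb M$ set $d_\varphi(p,q)=\int\varphi((0,p),(x,q))\,dx$ and $$d_\varphi^{[n]}(p,q)=\iint\ \prod_{i=0}^{n-1}\varphi\big((x_i,p_i),(x_{i+1},p_{i+1})\big)\prod_{0\le i<i+2\le j\le n}\big(1-\varphi((x_i,p_i),(x_j,p_j))\big)\,d(x_1,\dots,x_n)\,\mathbb Q^{n-1}(d(p_1,\dots,p_{n-1})),$$ where $x_0=0$, $p_0=p$, $p_n=q$. Suppose that some $n\in\mathbb N$ satisfies $$\operatorname*{ess\,sup}_{p\in\mathbb M}\int d_\varphi(p,q)\,\mathbb Q(dq)+\operatorname*{ess\,sup}_{p,q\in\mathbb M}d^{[n]}_\varphi(p,q)<\infty ,$$ the essential suprema referring to $\mathbb Q$ and $\mathbb Q\otimes\mathbb Q$. Then $t_T=t_T^{(r)}$ for all $r\in[1,\infty]$. -/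

import Mathlib

open MeasureTheory ProbabilityTheory
open scoped NNReal ENNReal unitInterval

namespace MarkedRCM

noncomputable section

/-- The space `𝕏 = ℝ^d × 𝕄` of marked points: a location in `ℝ^d` together with a mark. -/
abbrev Pt (d : ℕ) (M : Type*) : Type _ := (Fin d → ℝ) × M

/-- The reference measure `λ = λ_d ⊗ ℚ` on `ℝ^d × 𝕄`. -/
def refMeasure (d : ℕ) {M : Type*} [MeasurableSpace M] (Q : Measure M) : Measure (Pt d M) :=
  (volume : Measure (Fin d → ℝ)).prod Q

/-- A connection function of the stationary marked random connection model: a measurable and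
symmetric function `φ : (ℝ^d × 𝕄)² → [0,1]` that is translation invariant in the locations,
`φ((x,p),(y,q)) = φ((0,p),(y-x,q))`. -/
structure IsConnectionFunction {d : ℕ} {M : Type*} [MeasurableSpace M]
    (φ : Pt d M → Pt d M → I) : Prop where
  measurable : Measurable (fun z : Pt d M × Pt d M => φ z.1 z.2)
  symm : ∀ z w : Pt d M, φ z w = φ w z
  translation : ∀ (x y : Fin d → ℝ) (p q : M), φ (x, p) (y, q) = φ (0, p) (y - x, q)

/-- A number of `[0,1]`, seen in `[0,∞]`. -/
def prob (a : I) : ℝ≥0∞ := ENNReal.ofReal (a : ℝ)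

/-! ### The marked Poisson process and the random connection model

The Poisson process with intensity measure `t • (λ_d ⊗ ℚ)` is realised as the superposition, over
all unit cubes `k + [0,1]^d`, `k ∈ ℤ^d`, of independent Poisson samples: the cube of `k`
receives `N k` points, `N k` being Poisson distributed with parameter `t`, with independent
locations that are uniform in the cube and independent marks with distribution `ℚ`.
The `i`-th point of the cube of `k` has the label `(k, i)` and is present iff `i < N k`. The extra
label `none` stands for the additional deterministic vertex `v`. -/

/-- Labels of the points of the Poisson process. -/
abbrev Label (d : ℕ) : Type := (Fin d → ℤ) × ℕ

/-- Labels of the vertices of the augmented model: `none` for the added vertex, `some a` for the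
Poisson point with label `a`. -/
abbrev VLabel (d : ℕ) : Type := Option (Label d)

/-- The sample space: the numbers of points of the cubes; for every label a relative location in
the unit cube and a mark; for every unordered pair of labels a variable with values in `[0,1]`. -/
abbrev Sample (d : ℕ) (M : Type*) : Type _ :=
  ((Fin d → ℤ) → ℕ) × (Label d → (Fin d → I) × M) × (Sym2 (VLabel d) → I)

/-- The probability measure `ℙ_t`: all coordinates are independent, the numbers of points are
Poisson distributed with parameter `t`, the relative locations are uniform on the unit cube, the
marks have distribution `ℚ`, and the edge variables are uniform on `[0,1]`. -/
def law (d : ℕ) {M : Type*} [MeasurableSpace M] (Q : Measure M) [IsProbabilityMeasure Q]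
    (t : ℝ≥0) : Measure (Sample d M) :=
  (Measure.infinitePi (fun _ : Fin d → ℤ => poissonMeasure t)).prod
    ((Measure.infinitePi (fun _ : Label d => (volume : Measure (Fin d → I)).prod Q)).prod
      (Measure.infinitePi (fun _ : Sym2 (VLabel d) => (volume : Measure I))))

/-- The marked point that belongs to a label; `v` is the added vertex. -/
def position {d : ℕ} {M : Type*} (v : Pt d M) (ω : Sample d M) : VLabel d → Pt d M
  | none => v
  | some a => (fun j => (a.1 j : ℝ) + ((ω.2.1 a).1 j : ℝ), (ω.2.1 a).2)

/-- Whether the vertex with a given label belongs to `η + δ_v`. -/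
def IsPresent {d : ℕ} {M : Type*} (ω : Sample d M) : VLabel d → Prop
  | none => True
  | some a => a.2 < ω.1 a.1

/-- The random connection model `ξ^v` driven by `η + δ_v`: two distinct vertices form an edge iff
their edge variable is at most the value of the connection function. (Labels that are not present
are isolated in this graph.) -/
def graph {d : ℕ} {M : Type*} (φ : Pt d M → Pt d M → I) (hφ : ∀ z w, φ z w = φ w z)
    (v : Pt d M) (ω : Sample d M) : SimpleGraph (VLabel d) where
  Adj a b := a ≠ b ∧ IsPresent ω a ∧ IsPresent ω b ∧
    ω.2.2 s(a, b) ≤ φ (position v ω a) (position v ω b)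
  symm := ⟨fun a b h => ⟨h.1.symm, h.2.2.1, h.2.1, by
    rw [Sym2.eq_swap, hφ (position v ω b)]; exact h.2.2.2⟩⟩
  loopless := ⟨fun _ h => h.1 rfl⟩

/-- The vertex set `V^v` of the cluster of `v` in `ξ^v`. -/
def cluster {d : ℕ} {M : Type*} (φ : Pt d M → Pt d M → I) (hφ : ∀ z w, φ z w = φ w z)
    (v : Pt d M) (ω : Sample d M) : Set (VLabel d) :=
  {a | (graph φ hφ v ω).Reachable none a}

/-- The mean cluster size `c^v(t) = 𝔼_t |V^v| ∈ [1,∞]`. -/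
def meanCluster {d : ℕ} {M : Type*} [MeasurableSpace M] (Q : Measure M) [IsProbabilityMeasure Q]
    (φ : Pt d M → Pt d M → I) (hφ : ∀ z w, φ z w = φ w z) (t : ℝ≥0) (v : Pt d M) : ℝ≥0∞ :=
  ∫⁻ ω, ((cluster φ hφ v ω).encard : ℝ≥0∞) ∂(law d Q t)

/-! ### Critical intensities -/

/-- The second critical intensity of a general random connection model,
`t_T = sup {t ≥ 0 : esssup_{v ∈ 𝕏} 𝔼_t |V^v| < ∞}`, where the essential supremum refers to
`λ = λ_d ⊗ ℚ`. -/
def tT {d : ℕ} {M : Type*} [MeasurableSpace M] (Q : Measure M) [IsProbabilityMeasure Q]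
    (φ : Pt d M → Pt d M → I) (hφ : ∀ z w, φ z w = φ w z) : ℝ≥0∞ :=
  sSup {s : ℝ≥0∞ | ∃ t : ℝ≥0, s = t ∧
    essSup (fun v => meanCluster Q φ hφ t v) (refMeasure d Q) < ∞}

/-- The critical intensity `t_T^{(r)} = inf {t ≥ 0 : ‖c(t)‖_r = ∞}` for `r ∈ [1,∞]`, where
`‖c(t)‖_r` is the `L^r(ℚ)`-norm of `p ↦ c^{(0,p)}(t)`, and `inf ∅ = ∞`. -/
def tTr {d : ℕ} {M : Type*} [MeasurableSpace M] (Q : Measure M) [IsProbabilityMeasure Q]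
    (φ : Pt d M → Pt d M → I) (hφ : ∀ z w, φ z w = φ w z) (r : ℝ≥0∞) : ℝ≥0∞ :=
  sInf {s : ℝ≥0∞ | ∃ t : ℝ≥0, s = t ∧
    eLpNorm (fun p : M => meanCluster Q φ hφ t ((0, p) : Pt d M)) r Q = ∞}

/-! ### The integrability condition -/

/-- `d_φ(p,q) = ∫ φ((0,p),(x,q)) dx`. -/
def dφ {d : ℕ} {M : Type*} (φ : Pt d M → Pt d M → I) (p q : M) : ℝ≥0∞ :=
  ∫⁻ x : Fin d → ℝ, prob (φ (0, p) (x, q))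

/-- The points `z_0, …, z_n` of a path of length `n ≥ 1` with `z_0 = (0,p)`, `z_n = (x,q)` and
intermediate points `z_1, …, z_{n-1}`. -/
def pathPoint {d : ℕ} {M : Type*} (n : ℕ) (p q : M) (x : Fin d → ℝ) (z : Fin (n - 1) → Pt d M)
    (i : ℕ) : Pt d M :=
  if i = 0 then (0, p) else if h : i - 1 < n - 1 then z ⟨i - 1, h⟩ else (x, q)

/-- For `n ≥ 1`, the function `d_φ^{[n]}(p,q)`: the integral, over the locations `x_1, …, x_n` and
the marks `p_1, …, p_{n-1}`, of
`∏_{0 ≤ i < n} φ(z_i, z_{i+1}) * ∏_{0 ≤ i, i + 2 ≤ j ≤ n} (1 - φ(z_i, z_j))`, where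
`z_0 = (0,p)`, `z_i = (x_i,p_i)` for `0 < i < n` and `z_n = (x_n,q)`. -/
def dBracket {d : ℕ} {M : Type*} [MeasurableSpace M] (Q : Measure M) [IsProbabilityMeasure Q]
    (φ : Pt d M → Pt d M → I) (n : ℕ) (p q : M) : ℝ≥0∞ :=
  ∫⁻ x : Fin d → ℝ, ∫⁻ z : Fin (n - 1) → Pt d M,
    (∏ i ∈ Finset.range n, prob (φ (pathPoint n p q x z i) (pathPoint n p q x z (i + 1)))) *
      ∏ i ∈ Finset.range (n + 1), ∏ j ∈ Finset.Icc (i + 2) n,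
        prob (unitInterval.symm (φ (pathPoint n p q x z i) (pathPoint n p q x z j)))
    ∂(Measure.pi fun _ => (volume : Measure (Fin d → ℝ)).prod Q)

/-- The norm `‖L‖_{∞,1} = esssup_p ∫ L(p,q) ℚ(dq)`. -/
def normInftyOne {M : Type*} [MeasurableSpace M] (Q : Measure M) (L : M → M → ℝ≥0∞) : ℝ≥0∞ :=
  essSup (fun p => ∫⁻ q, L p q ∂Q) Q

/-- The norm `‖L‖_{∞,∞} = esssup_{p,q} L(p,q)`, with respect to `ℚ ⊗ ℚ`. -/
def normInftyInfty {M : Type*} [MeasurableSpace M] (Q : Measure M) (L : M → M → ℝ≥0∞) : ℝ≥0∞ :=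
  essSup (fun z : M × M => L z.1 z.2) (Q.prod Q)

end

end MarkedRCM

namespace MarkedRCM

/-! ### Infinite product measures -/

section InfinitePi

variable {ι κ Y : Type*} [MeasurableSpace Y] (μ : Measure Y) [IsProbabilityMeasure μ]

/-! Fix t and write c(p) for the mean cluster size at (0,p). The theorem rests on one inequality in
[0,∞], valid also where c is infinite (`ae_meanCluster_le`): for almost every p, c(p) ≤ Σ_{j<n}
(t‖d_φ‖_{∞,1})^j + tⁿ ‖d_φ^{[n]}‖_{∞,∞} ‖c‖₁. So finiteness of ‖c‖₁ forces c to be essentially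
bounded. On a probability space every L^r-norm lies between the L¹- and the L^∞-norm, hence all of
them are finite for the same t. Since c increases with t (`meanCluster_mono`), these t form a
down-closed set, and its supremum is the infimum of its complement (`sSup_eq_sInf_compl`).

The inequality comes from following a path. On a path from v to a vertex of its cluster, let x be
the last neighbour of v; beyond x the path avoids all neighbours of v (`reachSet_avoiding_subset`).
Iterating from x, with v added to the forbidden list, traces an induced path. The edges deciding one
step are independent of those used afterwards (`meanReach_le`), so each step contributes a factor φ
to the next vertex and factors 1 - φ to the earlier ones. After n steps the constraints are dropped
and an ordinary cluster remains at the end point. The Mecke formula (`poissonExp_sumErase`) turns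
the sums over Poisson points into integrals against tλ. Paths of fewer than n steps give the
geometric sum, once the factors 1 - φ are discarded; those of n steps give tⁿ ∫ d_φ^{[n]}(p,q) c(q)
ℚ(dq), because c depends on the mark only.

All this is done in bounded boxes, where the expectation of a Poisson functional is the explicit
series `poissonExp` and the cluster mean is a function of a finite multiset of positions. Monotone
convergence (`meanCluster_eq_iSup`) transfers it to the whole space. -/

open Classical in
-- The preimage of a cylinder is a product of a cylinder over S and one over the complement, so
-- gluing two independent samples along S gives a sample. The independence statements below come
-- from this.
theorem measurePreserving_piecewise (S : Set ι) :
    MeasurePreserving (fun p : (ι → Y) × (ι → Y) => S.piecewise p.1 p.2)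
      ((Measure.infinitePi fun _ : ι => μ).prod (Measure.infinitePi fun _ : ι => μ))
      (Measure.infinitePi fun _ : ι => μ) := by
  have hm : Measurable (fun p : (ι → Y) × (ι → Y) => S.piecewise p.1 p.2) := by
    refine measurable_pi_lambda _ fun i => ?_
    by_cases hi : i ∈ S
    · simp only [Set.piecewise, hi, if_true]
      exact (measurable_pi_apply i).comp measurable_fst
    · simp only [Set.piecewise, hi, if_false]
      exact (measurable_pi_apply i).comp measurable_snd
  refine ⟨hm, ?_⟩
  refine Measure.eq_infinitePi (fun _ : ι => μ) fun s t ht => ?_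
  rw [Measure.map_apply hm (MeasurableSet.pi s.countable_toSet fun i _ => ht i)]
  have : (fun p : (ι → Y) × (ι → Y) => S.piecewise p.1 p.2) ⁻¹' (s : Set ι).pi t
      = ((s.filter (· ∈ S) : Finset ι) : Set ι).pi t ×ˢ
        ((s.filter (· ∉ S) : Finset ι) : Set ι).pi t := by
    ext p
    simp only [Set.mem_preimage, Set.mem_pi, Finset.mem_coe, Set.mem_prod, Finset.mem_filter]
    constructor
    · intro h
      refine ⟨fun i hi => ?_, fun i hi => ?_⟩
      · simpa [Set.piecewise, hi.2] using h i hi.1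
      · simpa [Set.piecewise, hi.2] using h i hi.1
    · rintro ⟨h1, h2⟩ i hi
      by_cases hS : i ∈ S
      · simpa [Set.piecewise, hS] using h1 i ⟨hi, hS⟩
      · simpa [Set.piecewise, hS] using h2 i ⟨hi, hS⟩
  rw [this, Measure.prod_prod, Measure.infinitePi_pi _ (fun i _ => ht i),
    Measure.infinitePi_pi _ (fun i _ => ht i), Finset.prod_filter_mul_prod_filter_not]

/-- Two functions of disjoint sets of coordinates are independent. -/
theorem lintegral_infinitePi_resample (S : Set ι) {f : (ι → Y) → (ι → Y) → ℝ≥0∞}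
    (hf : Measurable (Function.uncurry f))
    (h1 : ∀ ω ω' ω'', (∀ i ∈ S, ω i = ω' i) → f ω ω'' = f ω' ω'')
    (h2 : ∀ ω ω' ω'', (∀ i ∉ S, ω i = ω' i) → f ω'' ω = f ω'' ω') :
    ∫⁻ ω, f ω ω ∂(Measure.infinitePi fun _ : ι => μ) =
      ∫⁻ ω', ∫⁻ ω, f ω ω' ∂(Measure.infinitePi fun _ : ι => μ)
        ∂(Measure.infinitePi fun _ : ι => μ) := by
  classical
  have hd : Measurable fun ω => f ω ω := hf.comp (measurable_id.prodMk measurable_id)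
  rw [← (measurePreserving_piecewise μ S).lintegral_comp hd]
  refine (lintegral_prod_symm _
    (hd.comp (measurePreserving_piecewise μ S).measurable).aemeasurable).trans ?_
  refine lintegral_congr fun ω' => lintegral_congr fun ω => ?_
  change f (S.piecewise ω ω') (S.piecewise ω ω') = _
  rw [h1 _ ω _ fun i hi => by simp [Set.piecewise, hi],
    h2 _ ω' _ fun i hi => by simp [Set.piecewise, hi]]

theorem lintegral_infinitePi_mul (S : Set ι) {f g : (ι → Y) → ℝ≥0∞}
    (hf : Measurable f) (hg : Measurable g)
    (h1 : ∀ ω ω', (∀ i ∈ S, ω i = ω' i) → f ω = f ω')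
    (h2 : ∀ ω ω', (∀ i ∉ S, ω i = ω' i) → g ω = g ω') :
    ∫⁻ ω, f ω * g ω ∂(Measure.infinitePi fun _ : ι => μ) =
      (∫⁻ ω, f ω ∂(Measure.infinitePi fun _ : ι => μ)) *
        ∫⁻ ω, g ω ∂(Measure.infinitePi fun _ : ι => μ) := by
  rw [lintegral_infinitePi_resample μ S (f := fun ω ω' => f ω * g ω')
    ((hf.comp measurable_fst).mul (hg.comp measurable_snd))
    (fun ω ω' ω'' h => by rw [h1 _ _ h]) (fun ω ω' ω'' h => by rw [h2 _ _ h])]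
  simp_rw [lintegral_mul_const _ hf]
  rw [lintegral_const_mul _ hg]

/-- An injection selects distinct, hence independent, coordinates. This allows relabelling of
vertices and restriction to the labels of one cube. -/
theorem measurePreserving_comp_injective {e : κ → ι} (he : Function.Injective e) :
    MeasurePreserving (fun ω : ι → Y => ω ∘ e)
      (Measure.infinitePi fun _ : ι => μ) (Measure.infinitePi fun _ : κ => μ) := by
  classical
  have hm : Measurable (fun ω : ι → Y => ω ∘ e) :=
    measurable_pi_lambda _ fun i => measurable_pi_apply (e i)
  refine ⟨hm, Measure.eq_infinitePi (fun _ : κ => μ) fun s t ht => ?_⟩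
  rw [Measure.map_apply hm (MeasurableSet.pi s.countable_toSet fun i _ => ht i)]
  have : (fun ω : ι → Y => ω ∘ e) ⁻¹' (s : Set κ).pi t
      = ((s.map ⟨e, he⟩ : Finset ι) : Set ι).pi
        (fun i => if h : ∃ k, e k = i then t h.choose else Set.univ) := by
    ext ω
    simp only [Set.mem_preimage, Set.mem_pi, Finset.mem_coe, Finset.mem_map,
      Function.Embedding.coeFn_mk, forall_exists_index, and_imp, forall_apply_eq_imp_iff₂]
    refine forall₂_congr fun k _ => ?_
    have h : ∃ k', e k' = e k := ⟨k, rfl⟩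
    rw [dif_pos h, he h.choose_spec]
    rfl
  rw [this, Measure.infinitePi_pi, Finset.prod_map]
  · refine Finset.prod_congr rfl fun k _ => ?_
    have h : ∃ k', e k' = e k := ⟨k, rfl⟩
    simp only [Function.Embedding.coeFn_mk]
    rw [dif_pos h, he h.choose_spec]
  · intro i _
    split_ifs
    · exact ht _
    · exact MeasurableSet.univ

end InfinitePi

/-! ### Reachability through a set of vertices -/

section Reach

variable {ι κ : Type*}

/-- The vertices that can be reached from `a` by a path with all later vertices in `S`. -/
def reachSet (r : ι → ι → Prop) (S : Set ι) (a : ι) : Set ι :=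
  {b | Relation.ReflTransGen (fun x y => y ∈ S ∧ r x y) a b}

/-- The elements of `S` that are not related to any member of the list `h`. -/
def avoiding (r : ι → ι → Prop) (h : List ι) (S : Set ι) : Set ι :=
  {x | x ∈ S ∧ ∀ y ∈ h, ¬ r y x}

theorem reachSet_mono {r r' : ι → ι → Prop} {S S' : Set ι} (a : ι)
    (h : ∀ x y, y ∈ S → r x y → y ∈ S' ∧ r' x y) : reachSet r S a ⊆ reachSet r' S' a :=
  fun _ hb => Relation.ReflTransGen.mono (fun x y hxy => h x y hxy.1 hxy.2) _ _ hb

theorem reachSet_congr {r r' : ι → ι → Prop} {S : Set ι} (a : ι)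
    (h : ∀ x, ∀ y ∈ S, r x y ↔ r' x y) : reachSet r S a = reachSet r' S a :=
  (reachSet_mono a fun x y hy hr => ⟨hy, (h x y hy).1 hr⟩).antisymm
    (reachSet_mono a fun x y hy hr => ⟨hy, (h x y hy).2 hr⟩)

theorem avoiding_congr {r r' : ι → ι → Prop} (h : List ι) {S : Set ι}
    (hr : ∀ x, ∀ y ∈ S, r x y ↔ r' x y) : avoiding r h S = avoiding r' h S := by
  ext x
  refine and_congr_right fun hx => forall₂_congr fun y _ => not_congr (hr y x hx)

/-- Following a path to the last visit of a neighbour of its starting point. -/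
theorem reachSet_avoiding_subset (r : ι → ι → Prop) (h : List ι) (S : Set ι) (a : ι) :
    reachSet r (avoiding r h S) a ⊆ {a} ∪ ⋃ x ∈ {x | x ∈ avoiding r h S ∧ r a x},
      reachSet r (avoiding r (a :: h) (S \ {x})) x := by
  intro b hb
  induction hb with
  | refl => exact Or.inl rfl
  | @tail b c _ hbc ih =>
    right
    obtain ⟨hc, hr⟩ := hbc
    -- A new neighbour of a restarts the tail there; any other vertex extends the current tail.
    by_cases hac : r a c
    · exact Set.mem_biUnion (x := c) ⟨hc, hac⟩ Relation.ReflTransGen.refl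
    · rcases ih with rfl | ih
      · exact absurd hr hac
      · obtain ⟨x, hx, hbx⟩ := Set.mem_iUnion₂.1 ih
        refine Set.mem_biUnion hx (hbx.tail ⟨⟨⟨hc.1, ?_⟩, ?_⟩, hr⟩)
        · rintro rfl
          exact hac hx.2
        · intro y hy
          rcases List.mem_cons.1 hy with rfl | hy
          · exact hac
          · exact hc.2 y hy

theorem reachSet_image (e : κ → ι) (r : ι → ι → Prop) (S : Set κ)
    (a : κ) : reachSet r (e '' S) (e a) = e '' reachSet (fun x y => r (e x) (e y)) S a := by
  ext b
  constructor
  · intro hb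
    induction hb with
    | refl => exact ⟨a, Relation.ReflTransGen.refl, rfl⟩
    | @tail b c _ hbc ih =>
      obtain ⟨b', hb', rfl⟩ := ih
      obtain ⟨⟨c', hc', rfl⟩, hr⟩ := hbc
      exact ⟨c', hb'.tail ⟨hc', hr⟩, rfl⟩
  · rintro ⟨b, hb, rfl⟩
    induction hb with
    | refl => exact Relation.ReflTransGen.refl
    | tail _ hbc ih => exact ih.tail ⟨⟨_, hbc.1, rfl⟩, hbc.2⟩

/-- A path has finitely many vertices, so it already runs in a single S n. -/
theorem reachSet_iUnion {r : ι → ι → Prop} {S : ℕ → Set ι} (hS : Monotone S) (a : ι) :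
    reachSet r (⋃ n, S n) a = ⋃ n, reachSet r (S n) a := by
  refine Set.Subset.antisymm (fun b hb => ?_) (Set.iUnion_subset fun n =>
    reachSet_mono a fun x y hy hr => ⟨Set.mem_iUnion_of_mem n hy, hr⟩)
  induction hb with
  | refl => exact Set.mem_iUnion_of_mem 0 Relation.ReflTransGen.refl
  | tail _ hbc ih =>
    obtain ⟨n, hn⟩ := Set.mem_iUnion.1 ih
    obtain ⟨m, hm⟩ := Set.mem_iUnion.1 hbc.1
    refine Set.mem_iUnion_of_mem (max n m) (Relation.ReflTransGen.tail
      (reachSet_mono a (fun x y hy hr => ⟨hS (le_max_left n m) hy, hr⟩) hn)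
      ⟨hS (le_max_right n m) hm, hbc.2⟩)

variable {Ω : Type*} [MeasurableSpace Ω]

theorem measurableSet_reachSet [Countable ι] {r : Ω → ι → ι → Prop} {S : Ω → Set ι}
    (hr : ∀ x y, MeasurableSet {ω | r ω x y}) (hS : ∀ x, MeasurableSet {ω | x ∈ S ω}) (a b : ι) :
    MeasurableSet {ω | b ∈ reachSet (r ω) (S ω) a} := by
  -- A n c is the event that c is the end of a path with exactly n steps.
  let A : ℕ → ι → Set Ω := fun n => Nat.rec (fun c => {_ω | c = a})
    (fun _ A c => ⋃ b, A b ∩ ({ω | c ∈ S ω} ∩ {ω | r ω b c})) n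
  have hA : ∀ n c, MeasurableSet (A n c) := by
    intro n
    induction n with
    | zero => exact fun c => MeasurableSet.const _
    | succ n ih => exact fun c => MeasurableSet.iUnion fun b => (ih b).inter ((hS c).inter (hr b c))
  have : {ω | b ∈ reachSet (r ω) (S ω) a} = ⋃ n, A n b := by
    ext ω
    constructor
    · intro (hb : Relation.ReflTransGen _ a b)
      induction hb with
      | refl => exact Set.mem_iUnion_of_mem 0 (rfl : a = a)
      | @tail b c _ hbc ih =>
        obtain ⟨n, hn⟩ := Set.mem_iUnion.1 ih
        exact Set.mem_iUnion_of_mem (n + 1) (Set.mem_iUnion_of_mem b ⟨hn, hbc⟩)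
    · intro hb
      obtain ⟨n, hn⟩ := Set.mem_iUnion.1 hb
      induction n generalizing b with
      | zero =>
        obtain rfl : b = a := hn
        exact Relation.ReflTransGen.refl
      | succ n ih =>
        obtain ⟨c, hc, hcb⟩ := Set.mem_iUnion.1 hn
        exact Relation.ReflTransGen.tail (ih c (Set.mem_iUnion_of_mem n hc) hc) hcb
  rw [this]
  exact MeasurableSet.iUnion fun n => hA n b

theorem encard_eq_tsum (s : Set ι) :
    ((s.encard : ℕ∞) : ℝ≥0∞) = ∑' b, s.indicator (fun _ => 1) b := by
  rw [← ENNReal.tsum_set_one, tsum_subtype s (fun _ => (1 : ℝ≥0∞))]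

theorem measurable_encard [Countable ι] {s : Ω → Set ι}
    (hs : ∀ b, MeasurableSet {ω | b ∈ s ω}) :
    Measurable fun ω => (((s ω).encard : ℕ∞) : ℝ≥0∞) := by
  simp_rw [encard_eq_tsum]
  refine Measurable.tsum fun b => ?_
  have : (fun ω => (s ω).indicator (fun _ => (1 : ℝ≥0∞)) b)
      = {ω | b ∈ s ω}.indicator (fun _ => 1) := by
    ext ω
    simp [Set.indicator]
  rw [this]
  exact measurable_const.indicator (hs b)

theorem encard_iUnion_eq_iSup {s : ℕ → Set ι} (hs : Monotone s) :
    (((⋃ n, s n).encard : ℕ∞) : ℝ≥0∞) = ⨆ n, (((s n).encard : ℕ∞) : ℝ≥0∞) := by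
  let _ : MeasurableSpace ι := ⊤
  have h (t : Set ι) : ((t.encard : ℕ∞) : ℝ≥0∞) = Measure.count t :=
    (Measure.count_apply (MeasurableSpace.measurableSet_top)).symm
  simp_rw [h]
  exact hs.measure_iUnion

end Reach

/-! ### Functionals of finite Poisson processes -/

section PoissonFunctional

universe u

variable {α β X : Type u} [MeasurableSpace α] [MeasurableSpace β] [MeasurableSpace X]

/-- Joint measurability of a parametrised functional of finite configurations. -/
def JMeasurable (f : α → Multiset X → ℝ≥0∞) : Prop :=
  ∀ m : ℕ, Measurable fun p : α × (Fin m → X) => f p.1 (List.ofFn p.2 : Multiset X)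

/-- Measurability of a functional of finite configurations. -/
def CMeasurable (F : Multiset X → ℝ≥0∞) : Prop :=
  ∀ m : ℕ, Measurable fun x : Fin m → X => F (List.ofFn x : Multiset X)

theorem CMeasurable.jMeasurable {F : Multiset X → ℝ≥0∞} (hF : CMeasurable F) :
    JMeasurable fun (_ : α) => F :=
  fun m => (hF m).comp measurable_snd

theorem JMeasurable.cMeasurable {f : α → Multiset X → ℝ≥0∞} (hf : JMeasurable f) (a : α) :
    CMeasurable (f a) :=
  fun m => (hf m).comp (measurable_const.prodMk measurable_id)

theorem JMeasurable.comp {f : α → Multiset X → ℝ≥0∞} (hf : JMeasurable f) {g : β → α}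
    (hg : Measurable g) : JMeasurable fun b => f (g b) :=
  fun m => (hf m).comp ((hg.comp measurable_fst).prodMk measurable_snd)

/-- Turns k points of the configuration into parameters, so that points can be integrated out one at
a time. -/
theorem JMeasurable.append {f : α → Multiset X → ℝ≥0∞} (hf : JMeasurable f) (k : ℕ) :
    JMeasurable fun (p : α × (Fin k → X)) s => f p.1 ((List.ofFn p.2 : Multiset X) + s) := by
  intro m
  have h : Measurable fun q : (α × (Fin k → X)) × (Fin m → X) =>
      (q.1.1, (Fin.append q.1.2 q.2 : Fin (k + m) → X)) := by
    refine (measurable_fst.comp measurable_fst).prodMk (measurable_pi_lambda _ fun i => ?_)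
    refine Fin.addCases (fun j => ?_) (fun j => ?_) i
    · simp only [Fin.append_left]
      exact (measurable_pi_apply j).comp (measurable_snd.comp measurable_fst)
    · simp only [Fin.append_right]
      exact (measurable_pi_apply j).comp measurable_snd
  simpa [Function.comp_def, List.ofFn_fin_append] using (hf (k + m)).comp h

theorem JMeasurable.cons {f : α → Multiset X → ℝ≥0∞} (hf : JMeasurable f) :
    JMeasurable fun (p : α × X) s => f p.1 (p.2 ::ₘ s) := by
  have h := (hf.append 1).comp (g := fun p : α × X => (p.1, fun _ : Fin 1 => p.2))
    (measurable_fst.prodMk (measurable_pi_lambda _ fun _ => measurable_snd))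
  simpa using h

theorem CMeasurable.cons {F : Multiset X → ℝ≥0∞} (hF : CMeasurable F) :
    JMeasurable fun (x : X) s => F (x ::ₘ s) :=
  (hF.jMeasurable (α := X)).cons.comp (measurable_id.prodMk measurable_id)

theorem CMeasurable.add {F : Multiset X → ℝ≥0∞} (hF : CMeasurable F) (k : ℕ) :
    JMeasurable fun (x : Fin k → X) s => F ((List.ofFn x : Multiset X) + s) :=
  ((hF.jMeasurable (α := Fin k → X)).append k).comp (measurable_id.prodMk measurable_id)

theorem JMeasurable.mul_left {f : α → Multiset X → ℝ≥0∞} (hf : JMeasurable f) {g : α → ℝ≥0∞}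
    (hg : Measurable g) : JMeasurable fun a s => g a * f a s :=
  fun m => (hg.comp measurable_fst).mul (hf m)

theorem JMeasurable.const_add {f : α → Multiset X → ℝ≥0∞} (hf : JMeasurable f) (c : ℝ≥0∞) :
    JMeasurable fun a s => c + f a s :=
  fun m => measurable_const.add (hf m)

/-- The iterated integral of a functional over `m` points. -/
noncomputable def pointIntegral (μ : Measure X) : ℕ → (Multiset X → ℝ≥0∞) → ℝ≥0∞
  | 0, F => F 0
  | m + 1, F => ∫⁻ x, pointIntegral μ m (fun s => F (x ::ₘ s)) ∂μ

section

variable (μ ν : Measure X) [IsFiniteMeasure μ] [IsFiniteMeasure ν]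

omit [IsFiniteMeasure μ] in
theorem pointIntegral_mono (m : ℕ) {F G : Multiset X → ℝ≥0∞} (h : ∀ s, F s ≤ G s) :
    pointIntegral μ m F ≤ pointIntegral μ m G := by
  induction m generalizing F G with
  | zero => exact h 0
  | succ m ih => exact lintegral_mono fun x => ih fun s => h _

theorem JMeasurable.measurable_pointIntegral {f : α → Multiset X → ℝ≥0∞} (hf : JMeasurable f)
    (m : ℕ) : Measurable fun a => pointIntegral μ m (f a) := by
  induction m generalizing α with
  | zero =>
    have h : Measurable fun a : α => (a, (Fin.elim0 : Fin 0 → X)) :=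
      measurable_id.prodMk measurable_const
    simpa [pointIntegral, Function.comp_def] using (hf 0).comp h
  | succ m ih => exact Measurable.lintegral_prod_right (ih hf.cons)

theorem JMeasurable.pointIntegral_add {f : α → Multiset X → ℝ≥0∞} (hf : JMeasurable f) (m : ℕ) :
    JMeasurable fun a s => pointIntegral μ m (fun t => f a (s + t)) :=
  fun k => (hf.append k).measurable_pointIntegral μ m

theorem lintegral_pointIntegral (ρ : Measure α) [SFinite ρ] {f : α → Multiset X → ℝ≥0∞}
    (hf : JMeasurable f) (m : ℕ) :
    ∫⁻ a, pointIntegral μ m (f a) ∂ρ = pointIntegral μ m (fun s => ∫⁻ a, f a s ∂ρ) := by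
  induction m generalizing f with
  | zero => rfl
  | succ m ih =>
    simp only [pointIntegral]
    rw [lintegral_lintegral_swap (hf.cons.measurable_pointIntegral μ m).aemeasurable]
    refine lintegral_congr fun x => ih ?_
    exact hf.cons.comp (measurable_id.prodMk measurable_const)

theorem pointIntegral_tsum (m : ℕ) {F : ℕ → Multiset X → ℝ≥0∞} (hF : ∀ n, CMeasurable (F n)) :
    pointIntegral μ m (fun s => ∑' n, F n s) = ∑' n, pointIntegral μ m (F n) := by
  induction m generalizing F with
  | zero => rfl
  | succ m ih =>
    simp only [pointIntegral]
    rw [← lintegral_tsum fun n => ((hF n).cons.measurable_pointIntegral μ m).aemeasurable]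
    exact lintegral_congr fun x => ih fun n => (hF n).cons.cMeasurable x

theorem pointIntegral_fun_add (m : ℕ) {F G : Multiset X → ℝ≥0∞} (hF : CMeasurable F) :
    pointIntegral μ m (fun s => F s + G s) = pointIntegral μ m F + pointIntegral μ m G := by
  induction m generalizing F G with
  | zero => rfl
  | succ m ih =>
    simp only [pointIntegral]
    rw [← lintegral_add_left (hF.cons.measurable_pointIntegral μ m)]
    exact lintegral_congr fun x => ih (hF.cons.cMeasurable x)

omit [IsFiniteMeasure μ] in
theorem pointIntegral_const_mul (m : ℕ) {c : ℝ≥0∞} (hc : c ≠ ∞) (F : Multiset X → ℝ≥0∞) :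
    pointIntegral μ m (fun s => c * F s) = c * pointIntegral μ m F := by
  induction m generalizing F with
  | zero => rfl
  | succ m ih => simp only [pointIntegral, ih, lintegral_const_mul' _ _ hc]

omit [IsFiniteMeasure μ] in
theorem pointIntegral_const (m : ℕ) (c : ℝ≥0∞) :
    pointIntegral μ m (fun _ => c) = c * μ Set.univ ^ m := by
  induction m with
  | zero => simp [pointIntegral]
  | succ m ih => simp [pointIntegral, ih, pow_succ, mul_assoc]

omit [IsFiniteMeasure μ] in
theorem pointIntegral_smul (c : ℝ≥0) (m : ℕ) (F : Multiset X → ℝ≥0∞) :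
    pointIntegral (c • μ) m F = (c : ℝ≥0∞) ^ m * pointIntegral μ m F := by
  induction m generalizing F with
  | zero => simp [pointIntegral]
  | succ m ih =>
    have : c • μ = (c : ℝ≥0∞) • μ := rfl
    simp only [pointIntegral, ih]
    rw [lintegral_const_mul' _ _ (by finiteness), this, lintegral_smul_measure, smul_eq_mul,
      pow_succ, mul_assoc]

theorem pointIntegral_map {Y : Type u} [MeasurableSpace Y] {T : X → Y} (hT : Measurable T) (m : ℕ)
    {F : Multiset Y → ℝ≥0∞} (hF : CMeasurable F) :
    pointIntegral (μ.map T) m F = pointIntegral μ m (fun s => F (s.map T)) := by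
  induction m generalizing F with
  | zero => simp [pointIntegral]
  | succ m ih =>
    simp only [pointIntegral, Multiset.map_cons]
    rw [lintegral_map (hF.cons.measurable_pointIntegral _ m) hT]
    exact lintegral_congr fun x => ih (hF.cons.cMeasurable _)

/-- The binomial theorem: each of the m points comes from μ or from ν. Peeling off the first point
reproduces Pascal's rule. -/
theorem pointIntegral_add_measure (m : ℕ) {F : Multiset X → ℝ≥0∞} (hF : CMeasurable F) :
    pointIntegral (μ + ν) m F = ∑ p ∈ Finset.HasAntidiagonal.antidiagonal m,
      m.choose p.1 • pointIntegral μ p.1 (fun s => pointIntegral ν p.2 (fun t => F (s + t))) := by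
  induction m generalizing F with
  | zero => simp [pointIntegral]
  | succ m ih =>
    rw [Finset.sum_antidiagonal_choose_succ_nsmul (M := ℝ≥0∞)
      (fun i j => pointIntegral μ i (fun s => pointIntegral ν j (fun t => F (s + t))))]
    have hx : ∀ x, pointIntegral (μ + ν) m (fun s => F (x ::ₘ s)) = _ :=
      fun x => ih (hF.cons.cMeasurable x)
    have hj : ∀ j, JMeasurable fun (x : X) s =>
        pointIntegral ν j (fun t => F (x ::ₘ (s + t))) :=
      fun j => hF.cons.pointIntegral_add ν j
    have hmeas : ∀ i j : ℕ, Measurable fun x : X =>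
        pointIntegral μ i (fun s => pointIntegral ν j (fun t => F (x ::ₘ (s + t)))) :=
      fun i j => (hj j).measurable_pointIntegral μ i
    rw [pointIntegral]
    simp only [hx]
    rw [lintegral_add_measure]
    simp only [nsmul_eq_mul]
    rw [lintegral_finsetSum _ fun p _ => (hmeas p.1 p.2).const_mul _,
      lintegral_finsetSum _ fun p _ => (hmeas p.1 p.2).const_mul _, add_comm]
    congr 1
    · refine Finset.sum_congr rfl fun p _ => ?_
      rw [lintegral_const_mul _ (hmeas p.1 p.2), lintegral_pointIntegral μ ν (hj p.2)]
      simp only [pointIntegral, Multiset.add_cons]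
    · refine Finset.sum_congr rfl fun p hp => ?_
      rw [lintegral_const_mul _ (hmeas p.1 p.2)]
      simp only [pointIntegral, Multiset.cons_add]
      rw [Nat.choose_symm_of_eq_add (Finset.HasAntidiagonal.mem_antidiagonal.1 hp).symm]

/-! ### Poisson expectations and superposition -/

/-- The expectation of a functional of a Poisson process with finite intensity measure `μ`. -/
noncomputable def poissonExp (F : Multiset X → ℝ≥0∞) : ℝ≥0∞ :=
  ENNReal.ofReal (Real.exp (-(μ Set.univ).toReal)) *
    ∑' m : ℕ, (m.factorial : ℝ≥0∞)⁻¹ * pointIntegral μ m F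

omit [IsFiniteMeasure μ] in
theorem poissonExp_mono {F G : Multiset X → ℝ≥0∞} (h : ∀ s, F s ≤ G s) :
    poissonExp μ F ≤ poissonExp μ G :=
  mul_le_mul_right (ENNReal.tsum_le_tsum fun m =>
    mul_le_mul_right (pointIntegral_mono μ m h) _) _

theorem JMeasurable.measurable_poissonExp {f : α → Multiset X → ℝ≥0∞} (hf : JMeasurable f) :
    Measurable fun a => poissonExp μ (f a) :=
  (Measurable.tsum fun m => (hf.measurable_pointIntegral μ m).const_mul _).const_mul _

theorem poissonExp_const (c : ℝ≥0∞) : poissonExp μ (fun _ => c) = c := by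
  have h : ∀ m : ℕ, (m.factorial : ℝ≥0∞)⁻¹ * pointIntegral μ m (fun _ => c)
      = c * ENNReal.ofReal ((μ Set.univ).toReal ^ m / m.factorial) := by
    intro m
    rw [pointIntegral_const, ENNReal.ofReal_div_of_pos (by positivity), ENNReal.ofReal_natCast,
      ENNReal.ofReal_pow ENNReal.toReal_nonneg, ENNReal.ofReal_toReal (by finiteness),
      ENNReal.div_eq_inv_mul, mul_left_comm]
  have hs := NormedSpace.expSeries_div_hasSum_exp (𝔸 := ℝ) (μ Set.univ).toReal
  rw [poissonExp, tsum_congr h, ENNReal.tsum_mul_left,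
    ← ENNReal.ofReal_tsum_of_nonneg (fun m => by positivity) hs.summable, hs.tsum_eq,
    mul_left_comm, ← ENNReal.ofReal_mul (Real.exp_pos _).le, ← Real.exp_eq_exp_ℝ, ← Real.exp_add]
  simp

theorem poissonExp_fun_add {F G : Multiset X → ℝ≥0∞} (hF : CMeasurable F) :
    poissonExp μ (fun s => F s + G s) = poissonExp μ F + poissonExp μ G := by
  rw [poissonExp, poissonExp, poissonExp, ← mul_add, ← ENNReal.tsum_add]
  congr 1
  exact tsum_congr fun m => by rw [← mul_add, pointIntegral_fun_add μ _ hF]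

omit [IsFiniteMeasure μ] in
theorem poissonExp_const_mul {c : ℝ≥0∞} (hc : c ≠ ∞) (F : Multiset X → ℝ≥0∞) :
    poissonExp μ (fun s => c * F s) = c * poissonExp μ F := by
  have h : ∀ m : ℕ, (m.factorial : ℝ≥0∞)⁻¹ * pointIntegral μ m (fun s => c * F s)
      = c * ((m.factorial : ℝ≥0∞)⁻¹ * pointIntegral μ m F) := fun m => by
    rw [pointIntegral_const_mul μ _ hc, mul_left_comm]
  rw [poissonExp, tsum_congr h, ENNReal.tsum_mul_left, mul_left_comm, poissonExp]

theorem poissonExp_map {Y : Type u} [MeasurableSpace Y] {T : X → Y} (hT : Measurable T)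
    {F : Multiset Y → ℝ≥0∞} (hF : CMeasurable F) :
    poissonExp (μ.map T) F = poissonExp μ (fun s => F (s.map T)) := by
  simp only [poissonExp, pointIntegral_map μ hT _ hF, Measure.map_apply hT MeasurableSet.univ,
    Set.preimage_univ]

theorem choose_mul_inv_factorial (i j : ℕ) :
    ((i + j).factorial : ℝ≥0∞)⁻¹ * ((i + j).choose i : ℝ≥0∞)
      = (i.factorial : ℝ≥0∞)⁻¹ * (j.factorial : ℝ≥0∞)⁻¹ := by
  have h : (i + j).choose i * i.factorial * j.factorial = (i + j).factorial := by
    rw [Nat.choose_symm_add, Nat.add_choose_mul_factorial_mul_factorial]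
  have hi : (i.factorial : ℝ≥0∞) ≠ 0 := by exact_mod_cast i.factorial_ne_zero
  have hj : (j.factorial : ℝ≥0∞) ≠ 0 := by exact_mod_cast j.factorial_ne_zero
  have hc : ((i + j).choose i : ℝ≥0∞) ≠ 0 := by
    exact_mod_cast (Nat.choose_pos (Nat.le_add_right i j)).ne'
  rw [← h]
  push_cast
  rw [ENNReal.mul_inv (by right; finiteness) (by right; exact hj),
    ENNReal.mul_inv (by right; finiteness) (by right; exact hi)]
  rw [mul_comm, ← mul_assoc, ← mul_assoc, ENNReal.mul_inv_cancel hc (by finiteness), one_mul]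

/-- The superposition of independent Poisson processes is a Poisson process. -/
theorem poissonExp_add_measure {F : Multiset X → ℝ≥0∞} (hF : CMeasurable F) :
    poissonExp (μ + ν) F = poissonExp μ (fun s => poissonExp ν (fun t => F (s + t))) := by
  have hm : ∀ j, CMeasurable fun s => (j.factorial : ℝ≥0∞)⁻¹ *
      pointIntegral ν j (fun t => F (s + t)) := fun j m =>
    (((hF.jMeasurable (α := PUnit.{u+1})).pointIntegral_add ν j).cMeasurable
      PUnit.unit m).const_mul _
  simp only [poissonExp]
  have h1 : ∀ i : ℕ, (i.factorial : ℝ≥0∞)⁻¹ * pointIntegral μ i (fun s =>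
      ENNReal.ofReal (Real.exp (-(ν Set.univ).toReal)) *
        ∑' j : ℕ, (j.factorial : ℝ≥0∞)⁻¹ * pointIntegral ν j (fun t => F (s + t)))
      = ENNReal.ofReal (Real.exp (-(ν Set.univ).toReal)) * ∑' j : ℕ, (i.factorial : ℝ≥0∞)⁻¹ *
        (j.factorial : ℝ≥0∞)⁻¹ *
          pointIntegral μ i (fun s => pointIntegral ν j (fun t => F (s + t))) := by
    intro i
    rw [pointIntegral_const_mul μ i (by finiteness), pointIntegral_tsum μ i hm, mul_left_comm,
      ← ENNReal.tsum_mul_left]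
    congr 2
    ext j
    rw [pointIntegral_const_mul μ i (by
      simpa using j.factorial_ne_zero), mul_assoc]
  rw [tsum_congr h1, ENNReal.tsum_mul_left, ← mul_assoc, ← ENNReal.ofReal_mul (Real.exp_pos _).le,
    ← Real.exp_add, Measure.add_apply, ENNReal.toReal_add (by finiteness) (by finiteness), neg_add]
  congr 1
  -- The double series over (i,j) is regrouped along i + j = m.
  rw [← ENNReal.tsum_prod, ← Finset.HasAntidiagonal.sigmaAntidiagonalEquivProd.tsum_eq,
    ENNReal.tsum_sigma']
  refine tsum_congr fun m => ?_
  rw [pointIntegral_add_measure μ ν m hF, Finset.mul_sum]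
  refine Eq.trans ?_ (Finset.tsum_subtype (Finset.HasAntidiagonal.antidiagonal m)
    fun p : ℕ × ℕ => (p.1.factorial : ℝ≥0∞)⁻¹ * (p.2.factorial : ℝ≥0∞)⁻¹ *
      pointIntegral μ p.1 (fun s => pointIntegral ν p.2 (fun t => F (s + t)))).symm
  refine Finset.sum_congr rfl fun p hp => ?_
  obtain rfl := Finset.HasAntidiagonal.mem_antidiagonal.1 hp
  rw [nsmul_eq_mul, ← mul_assoc, choose_mul_inv_factorial]

/-- By superposition, ν adds to the process of μ an independent process with intensity ν - μ, and
additional points only increase F. -/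
theorem poissonExp_mono_measure {F : Multiset X → ℝ≥0∞} (hF : CMeasurable F)
    (hmono : ∀ s t, F s ≤ F (s + t)) (h : μ ≤ ν) : poissonExp μ F ≤ poissonExp ν F := by
  have hν : ν = μ + (ν - μ) := by rw [add_comm, Measure.sub_add_cancel_of_le h]
  rw [hν, poissonExp_add_measure μ (ν - μ) hF]
  refine poissonExp_mono μ fun s => ?_
  calc F s = poissonExp (ν - μ) (fun _ => F s) := (poissonExp_const _ _).symm
    _ ≤ _ := poissonExp_mono _ fun t => hmono s t

/-! ### The Mecke formula -/

open Classical in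
/-- The sum over the points `x` of a configuration `s` of `f x (s - x)`. -/
noncomputable def sumErase (f : X → Multiset X → ℝ≥0∞) (s : Multiset X) : ℝ≥0∞ :=
  (s.map fun x => f x (s.erase x)).sum

omit [MeasurableSpace X] in
theorem sumErase_cons (f : X → Multiset X → ℝ≥0∞) (x : X) (s : Multiset X) :
    sumErase f (x ::ₘ s) = f x s + sumErase (fun y r => f y (x ::ₘ r)) s := by
  classical
  simp only [sumErase, Multiset.map_cons, Multiset.sum_cons, Multiset.erase_cons_head]
  congr 2
  refine Multiset.map_congr rfl fun y hy => ?_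
  -- Points may coincide; erasing either copy leaves the same multiset.
  by_cases h : y = x
  · subst h
    rw [Multiset.erase_cons_head, Multiset.cons_erase hy]
  · rw [Multiset.erase_cons_tail _ (Ne.symm h)]

theorem JMeasurable.sumErase {f : α × X → Multiset X → ℝ≥0∞} (hf : JMeasurable f) :
    JMeasurable fun a s => sumErase (fun x r => f (a, x) r) s := by
  intro m
  induction m generalizing α with
  | zero => simp [MarkedRCM.sumErase]
  | succ m ih =>
    have h1 : ∀ p : α × (Fin (m + 1) → X),
        MarkedRCM.sumErase (fun x r => f (p.1, x) r) (List.ofFn p.2 : Multiset X)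
        = f (p.1, p.2 0) (List.ofFn (fun i : Fin m => p.2 i.succ) : Multiset X)
          + MarkedRCM.sumErase (fun y r => f (p.1, y) (p.2 0 ::ₘ r))
            (List.ofFn (fun i : Fin m => p.2 i.succ) : Multiset X) := by
      intro p
      rw [List.ofFn_succ, ← Multiset.cons_coe, sumErase_cons]
    simp only [h1]
    have ht : Measurable fun p : α × (Fin (m + 1) → X) => fun i : Fin m => p.2 i.succ :=
      measurable_pi_lambda _ fun i => (measurable_pi_apply i.succ).comp measurable_snd
    have h0 : Measurable fun p : α × (Fin (m + 1) → X) => (p.1, p.2 0) :=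
      measurable_fst.prodMk ((measurable_pi_apply 0).comp measurable_snd)
    refine ((hf m).comp (h0.prodMk ht)).add ?_
    have hg : JMeasurable fun (q : (α × X) × X) r => f (q.1.1, q.2) (q.1.2 ::ₘ r) :=
      hf.cons.comp (g := fun q : (α × X) × X => ((q.1.1, q.2), q.1.2)) (by fun_prop)
    exact (ih hg).comp (h0.prodMk ht)

/-- By symmetry each of the m + 1 points contributes equally as the distinguished one. In the
induction the first point is either distinguished itself or exchanged with the distinguished one by
Tonelli. -/
theorem pointIntegral_sumErase (m : ℕ) {f : X → Multiset X → ℝ≥0∞} (hf : JMeasurable f) :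
    pointIntegral μ (m + 1) (sumErase f) = (m + 1 : ℕ) * ∫⁻ x, pointIntegral μ m (f x) ∂μ := by
  induction m generalizing f with
  | zero =>
    simp only [pointIntegral, sumErase_cons]
    simp [sumErase]
  | succ m ih =>
    rw [pointIntegral]
    simp only [sumErase_cons]
    simp_rw [pointIntegral_fun_add μ _ (hf.cMeasurable _)]
    rw [lintegral_add_left (hf.measurable_pointIntegral μ _)]
    have h : ∀ x, pointIntegral μ (m + 1) (fun s => sumErase (fun y r => f y (x ::ₘ r)) s)
        = (m + 1 : ℕ) * ∫⁻ y, pointIntegral μ m (fun s => f y (x ::ₘ s)) ∂μ :=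
      fun x => ih (hf.cons.comp (measurable_id.prodMk measurable_const))
    simp_rw [h]
    rw [lintegral_const_mul' _ _ (by finiteness), lintegral_lintegral_swap
      ((hf.cons.comp measurable_swap).measurable_pointIntegral μ m).aemeasurable]
    simp only [pointIntegral]
    push_cast
    ring

/-- The Mecke formula. -/
theorem poissonExp_sumErase {f : X → Multiset X → ℝ≥0∞} (hf : JMeasurable f) :
    poissonExp μ (sumErase f) = ∫⁻ x, poissonExp μ (f x) ∂μ := by
  simp only [poissonExp]
  rw [lintegral_const_mul' _ _ (by finiteness), lintegral_tsum
    fun m => ((hf.measurable_pointIntegral μ m).const_mul _).aemeasurable,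
    tsum_eq_zero_add' ENNReal.summable]
  congr 1
  -- The empty configuration contributes nothing; after the index shift, (m+1)/(m+1)! becomes 1/m!.
  have h0 : pointIntegral μ 0 (sumErase f) = 0 := by simp [pointIntegral, sumErase]
  rw [h0, mul_zero, zero_add]
  refine tsum_congr fun m => ?_
  have hm : (m.factorial : ℝ≥0∞) ≠ 0 := by exact_mod_cast m.factorial_ne_zero
  rw [pointIntegral_sumErase μ m hf, lintegral_const_mul' _ _ (by simpa using m.factorial_ne_zero),
    ← mul_assoc, Nat.factorial_succ]
  congr 1
  push_cast
  rw [ENNReal.mul_inv (by right; finiteness) (by right; exact hm), mul_comm, ← mul_assoc,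
    ENNReal.mul_inv_cancel (by positivity) (by finiteness), one_mul]

end

end PoissonFunctional

/-! ### Random connection models on finite configurations -/

section RandomGraph

universe u

variable {ι κ : Type*} {X : Type u}

/-- The edges of the random connection model with vertex positions `z` and edge variables `U`. -/
def edgeRel (φ : X → X → I) (z : ι → X) (U : Sym2 ι → I) (x y : ι) : Prop :=
  U s(x, y) ≤ φ (z x) (z y)

/-- The law of the edge variables. -/
noncomputable def edgeLaw (ι : Type*) : Measure (Sym2 ι → I) :=
  Measure.infinitePi fun _ : Sym2 ι => (volume : Measure I)

instance (ι : Type*) : IsProbabilityMeasure (edgeLaw ι) := by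
  unfold edgeLaw
  infer_instance

/-- The mean number of vertices that can be reached from `a` through those vertices of `S` which
are not adjacent to any vertex of the list `h`. -/
noncomputable def meanReach (φ : X → X → I) (z : ι → X) (S : Set ι) (h : List ι) (a : ι) : ℝ≥0∞ :=
  ∫⁻ U, (((reachSet (edgeRel φ z U) (avoiding (edgeRel φ z U) h S) a).encard : ℕ∞) : ℝ≥0∞)
    ∂edgeLaw ι

theorem avoiding_nil (r : ι → ι → Prop) (S : Set ι) : avoiding r [] S = S := by
  simp [avoiding]

theorem meanReach_mono (φ : X → X → I) (z : ι → X) {S T : Set ι} (hST : S ⊆ T) (h : List ι)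
    (a : ι) : meanReach φ z S h a ≤ meanReach φ z T [] a := by
  refine lintegral_mono fun U => ?_
  rw [avoiding_nil]
  exact ENat.toENNReal_mono (Set.encard_le_encard
    (reachSet_mono a fun x y hy hr => ⟨hST hy.1, hr⟩))

theorem measurable_encard_reachSet [MeasurableSpace X] {φ : X → X → I}
    (hφ : Measurable fun p : X × X => φ p.1 p.2) [Countable ι] {Ω : Type*} [MeasurableSpace Ω]
    {z : Ω → ι → X} {U : Ω → Sym2 ι → I} (hz : ∀ i, Measurable fun ω => z ω i)
    (hU : ∀ e, Measurable fun ω => U ω e)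
    {S : Ω → Set ι} (hS : ∀ i, MeasurableSet {ω | i ∈ S ω}) (h : List ι) (a : ι) :
    Measurable fun ω => (((reachSet (edgeRel φ (z ω) (U ω))
      (avoiding (edgeRel φ (z ω) (U ω)) h (S ω)) a).encard : ℕ∞) : ℝ≥0∞) := by
  have hr : ∀ x y, MeasurableSet {ω | edgeRel φ (z ω) (U ω) x y} := fun x y =>
    measurableSet_le (hU _) (hφ.comp ((hz x).prodMk (hz y)))
  refine measurable_encard fun b => measurableSet_reachSet hr (fun x => ?_) a b
  have : {ω | x ∈ avoiding (edgeRel φ (z ω) (U ω)) h (S ω)}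
      = {ω | x ∈ S ω} ∩ ⋂ y ∈ {y | y ∈ h}, {ω | edgeRel φ (z ω) (U ω) y x}ᶜ := by
    ext ω
    simp [avoiding]
  rw [this]
  exact (hS x).inter (h.finite_toSet.measurableSet_biInter fun y _ => (hr y x).compl)

/-- Only edge variables between vertices in the image of e matter, and these have the law of the
edge variables over κ. -/
theorem meanReach_image (φ : X → X → I) (z : ι → X) {e : κ → ι} (he : Function.Injective e)
    (hφ : ∀ S a, Measurable fun U : Sym2 κ → I =>
      (((reachSet (edgeRel φ (z ∘ e) U) S a).encard : ℕ∞) : ℝ≥0∞)) (S : Set κ) (a : κ) :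
    meanReach φ z (e '' S) [] (e a) = meanReach φ (z ∘ e) S [] a := by
  unfold meanReach edgeLaw
  simp only [avoiding_nil]
  rw [← (measurePreserving_comp_injective (volume : Measure I)
    (Sym2.map.injective he)).lintegral_comp (hφ S a)]
  refine lintegral_congr fun U => ?_
  rw [reachSet_image, he.encard_image]
  rfl

/-! #### One step of the exploration -/

theorem lintegral_edge_le (e : Sym2 ι) (p : I) :
    ∫⁻ U, {U : Sym2 ι → I | U e ≤ p}.indicator (fun _ => 1) U ∂edgeLaw ι = prob p := by
  have hm : MeasurableSet {u : I | u ≤ p} := measurableSet_Iic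
  have := (measurePreserving_eval_infinitePi (fun _ : Sym2 ι => (volume : Measure I))
    e).measure_preimage hm.nullMeasurableSet
  refine (lintegral_indicator_const (hm.preimage (measurable_pi_apply e)) 1).trans ?_
  rw [one_mul]
  refine Eq.trans this ?_
  change volume (Set.Iic p) = _
  rw [unitInterval.volume_Iic]
  rfl

theorem lintegral_edge_not_le (e : Sym2 ι) (p : I) :
    ∫⁻ U, {U : Sym2 ι → I | ¬ U e ≤ p}.indicator (fun _ => 1) U ∂edgeLaw ι
      = prob (unitInterval.symm p) := by
  have hm : MeasurableSet {u : I | ¬ u ≤ p} := measurableSet_Iic.compl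
  have := (measurePreserving_eval_infinitePi (fun _ : Sym2 ι => (volume : Measure I))
    e).measure_preimage hm.nullMeasurableSet
  refine (lintegral_indicator_const (hm.preimage (measurable_pi_apply e)) 1).trans ?_
  rw [one_mul]
  refine Eq.trans this ?_
  have : {u : I | ¬ u ≤ p} = Set.Ioi p := by ext u; simp
  rw [this, unitInterval.volume_Ioi]
  rfl

/-- The probability that a new vertex at `x` is adjacent to `v` but not to the points of `h`. -/
noncomputable def stepWeight (φ : X → X → I) (h : List X) (v x : X) : ℝ≥0∞ :=
  prob (φ v x) * (h.map fun y => prob (unitInterval.symm (φ y x))).prod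

theorem measurableSet_edgeRel (φ : X → X → I) (z : ι → X) (x y : ι) :
    MeasurableSet {U : Sym2 ι → I | edgeRel φ z U x y} :=
  (measurable_pi_apply s(x, y)) measurableSet_Iic

theorem measurableSet_forall_not_edgeRel (φ : X → X → I) (z : ι → X) (h : List ι) (x : ι) :
    MeasurableSet {U : Sym2 ι → I | ∀ y ∈ h, ¬ edgeRel φ z U y x} := by
  have : {U : Sym2 ι → I | ∀ y ∈ h, ¬ edgeRel φ z U y x}
      = ⋂ y ∈ {y | y ∈ h}, {U | edgeRel φ z U y x}ᶜ := by
    ext U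
    simp
  rw [this]
  exact h.finite_toSet.measurableSet_biInter fun y _ => (measurableSet_edgeRel φ z y x).compl

theorem indicator_one_mul {α : Type*} {A B C : Set α} {u : α} (h : u ∈ C ↔ u ∈ A ∧ u ∈ B) :
    C.indicator (fun _ => (1 : ℝ≥0∞)) u
      = A.indicator (fun _ => 1) u * B.indicator (fun _ => 1) u := by
  by_cases hA : u ∈ A <;> by_cases hB : u ∈ B <;> simp [Set.indicator, h, hA, hB]

theorem indicator_one_congr {α : Type*} {A : Set α} {u u' : α} (h : u ∈ A ↔ u' ∈ A) :
    A.indicator (fun _ => (1 : ℝ≥0∞)) u = A.indicator (fun _ => 1) u' := by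
  by_cases hA : u' ∈ A <;> simp [Set.indicator, h, hA]

/-- Distinct members of h give distinct, hence independent, edges to x. -/
theorem lintegral_forall_not_edgeRel (φ : X → X → I) (z : ι → X) {h : List ι} (hh : h.Nodup)
    (x : ι) :
    ∫⁻ U, {U : Sym2 ι → I | ∀ y ∈ h, ¬ edgeRel φ z U y x}.indicator (fun _ => 1) U ∂edgeLaw ι
      = (h.map fun y => prob (unitInterval.symm (φ (z y) (z x)))).prod := by
  induction h with
  | nil => simp
  | cons y h ih =>
    have hy := (List.nodup_cons.1 hh).1
    rw [List.map_cons, List.prod_cons, ← ih (List.nodup_cons.1 hh).2,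
      ← lintegral_edge_not_le s(y, x) (φ (z y) (z x)), edgeLaw]
    rw [← lintegral_infinitePi_mul (volume : Measure I) {s(y, x)}]
    · refine lintegral_congr fun U => ?_
      exact indicator_one_mul List.forall_mem_cons
    · exact measurable_const.indicator (measurableSet_edgeRel φ z y x).compl
    · exact measurable_const.indicator (measurableSet_forall_not_edgeRel φ z h x)
    · intro U U' hU
      simp only [Set.indicator, Set.mem_ofPred_eq, hU _ rfl]
    · intro U U' hU
      have : (∀ w ∈ h, ¬ edgeRel φ z U w x) ↔ ∀ w ∈ h, ¬ edgeRel φ z U' w x := by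
        refine forall₂_congr fun w hw => ?_
        rw [edgeRel, edgeRel, hU s(w, x)]
        rw [Set.mem_singleton_iff, Sym2.congr_left]
        rintro rfl
        exact hy hw
      exact indicator_one_congr this

theorem lintegral_stepWeight (φ : X → X → I) (z : ι → X) {a : ι} {h : List ι}
    (hh : (a :: h).Nodup) (x : ι) :
    ∫⁻ U, {U : Sym2 ι → I | edgeRel φ z U a x ∧ ∀ y ∈ h, ¬ edgeRel φ z U y x}.indicator
      (fun _ => 1) U ∂edgeLaw ι = stepWeight φ (h.map z) (z a) (z x) := by
  have ha := (List.nodup_cons.1 hh).1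
  rw [stepWeight, List.map_map]
  refine Eq.trans ?_ (congrArg₂ (· * ·) (lintegral_edge_le s(a, x) (φ (z a) (z x)))
    (lintegral_forall_not_edgeRel φ z (List.nodup_cons.1 hh).2 x))
  simp only [edgeLaw]
  rw [← lintegral_infinitePi_mul (volume : Measure I) {s(a, x)}]
  · exact lintegral_congr fun U => indicator_one_mul Iff.rfl
  · exact measurable_const.indicator (measurableSet_edgeRel φ z a x)
  · exact measurable_const.indicator (measurableSet_forall_not_edgeRel φ z h x)
  · intro U U' hU
    simp only [Set.indicator, Set.mem_ofPred_eq, hU _ rfl]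
  · intro U U' hU
    have : (∀ w ∈ h, ¬ edgeRel φ z U w x) ↔ ∀ w ∈ h, ¬ edgeRel φ z U' w x := by
      refine forall₂_congr fun w hw => ?_
      rw [edgeRel, edgeRel, hU s(w, x)]
      rw [Set.mem_singleton_iff, Sym2.congr_left]
      rintro rfl
      exact ha hw
    exact indicator_one_congr this

theorem toENNReal_sum (S : Finset ι) (f : ι → ℕ∞) :
    ((∑ x ∈ S, f x : ℕ∞) : ℝ≥0∞) = ∑ x ∈ S, (f x : ℝ≥0∞) :=
  map_sum ENat.toENNRealRingHom f S

open Classical in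
-- A union bound over the last neighbour x of a on a path; the 1 counts a itself.
theorem encard_reachSet_avoiding_le (r : ι → ι → Prop) (h : List ι) (S : Finset ι) (a : ι) :
    (((reachSet r (avoiding r h S) a).encard : ℕ∞) : ℝ≥0∞) ≤
      1 + ∑ x ∈ S, if r a x ∧ ∀ y ∈ h, ¬ r y x then
        (((reachSet r (avoiding r (a :: h) ((S : Set ι) \ {x})) x).encard : ℕ∞) : ℝ≥0∞)
        else 0 := by
  have h1 : (reachSet r (avoiding r h S) a).encard ≤ 1 + ∑ x ∈ S,
      if r a x ∧ ∀ y ∈ h, ¬ r y x then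
        (reachSet r (avoiding r (a :: h) ((S : Set ι) \ {x})) x).encard else 0 := by
    refine (Set.encard_le_encard (reachSet_avoiding_subset r h S a)).trans
      ((Set.encard_union_le _ _).trans ?_)
    rw [Set.encard_singleton]
    refine add_le_add_right ?_ 1
    rw [← Finset.sum_filter]
    have : (⋃ x ∈ {x | x ∈ avoiding r h S ∧ r a x},
        reachSet r (avoiding r (a :: h) ((S : Set ι) \ {x})) x)
        = ⋃ x ∈ S.filter fun x => r a x ∧ ∀ y ∈ h, ¬ r y x,
        reachSet r (avoiding r (a :: h) ((S : Set ι) \ {x})) x := by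
      ext b
      simp only [avoiding, Set.mem_iUnion, Finset.mem_filter, Set.mem_ofPred_eq, Finset.mem_coe]
      grind
    rw [this]
    exact Finset.set_encard_biUnion_le _ _
  refine (ENat.toENNReal_mono h1).trans (le_of_eq ?_)
  rw [ENat.toENNReal_add, ENat.toENNReal_one]
  congr 1
  rw [toENNReal_sum]
  refine Finset.sum_congr rfl fun x _ => ?_
  split_ifs
  · rfl
  · exact ENat.toENNReal_zero

/-- One exploration step in the mean. The event that x is admissible and the set reached beyond x
involve disjoint families of edges, so the expectation of their product factorises. -/
theorem meanReach_le [MeasurableSpace X] {φ : X → X → I}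
    (hφ : Measurable fun p : X × X => φ p.1 p.2) [Countable ι] [DecidableEq ι] (z : ι → X)
    {h : List ι} {S : Finset ι} {a : ι} (hh : (a :: h).Nodup) (hS : ∀ y ∈ a :: h, y ∉ S) :
    meanReach φ z S h a ≤ 1 + ∑ x ∈ S, stepWeight φ (h.map z) (z a) (z x) *
      meanReach φ z (S.erase x : Finset ι) (a :: h) x := by
  classical
  have hm : ∀ x, Measurable fun U : Sym2 ι → I => (((reachSet (edgeRel φ z U)
      (avoiding (edgeRel φ z U) (a :: h) ((S : Set ι) \ {x})) x).encard : ℕ∞) : ℝ≥0∞) := fun x =>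
    measurable_encard_reachSet hφ (z := fun _ => z) (U := fun U => U)
      (S := fun _ => (S : Set ι) \ {x}) (fun i => measurable_const)
      (fun e => measurable_pi_apply e) (fun i => MeasurableSet.const _) _ _
  have hm' : ∀ x, Measurable fun U : Sym2 ι → I =>
      {U : Sym2 ι → I | edgeRel φ z U a x ∧ ∀ y ∈ h, ¬ edgeRel φ z U y x}.indicator
        (fun _ => (1 : ℝ≥0∞)) U := fun x => measurable_const.indicator
    ((measurableSet_edgeRel φ z a x).inter (measurableSet_forall_not_edgeRel φ z h x))
  calc meanReach φ z S h a ≤ ∫⁻ U, (1 + ∑ x ∈ S,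
        {U : Sym2 ι → I | edgeRel φ z U a x ∧ ∀ y ∈ h, ¬ edgeRel φ z U y x}.indicator
        (fun _ => 1) U * (((reachSet (edgeRel φ z U)
          (avoiding (edgeRel φ z U) (a :: h) ((S : Set ι) \ {x})) x).encard : ℕ∞) : ℝ≥0∞))
          ∂edgeLaw ι := by
        refine lintegral_mono fun U =>
          (encard_reachSet_avoiding_le (edgeRel φ z U) h S a).trans (le_of_eq ?_)
        refine congrArg (1 + ·) (Finset.sum_congr rfl fun x _ => ?_)
        simp only [Set.indicator, Set.mem_ofPred_eq]
        split_ifs <;> simp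
    _ = _ := by
        rw [lintegral_add_left measurable_const, lintegral_const, measure_univ, mul_one]
        refine congrArg (1 + ·) ((lintegral_finsetSum _ fun x _ => (hm' x).mul (hm x)).trans
          (Finset.sum_congr rfl fun x hx => ?_))
        rw [← lintegral_stepWeight φ z hh x, meanReach, Finset.coe_erase]
        -- The edges with no endpoint in S \ {x} decide whether x is admissible; every edge tested
        -- beyond x has an endpoint in S \ {x}.
        refine lintegral_infinitePi_mul (volume : Measure I)
          {e | ∀ c ∈ (S : Set ι) \ {x}, c ∉ e} (hm' x) (hm x) (fun U U' hU => ?_)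
          fun U U' hU => ?_
        · have hE : ∀ y ∈ a :: h, (edgeRel φ z U y x ↔ edgeRel φ z U' y x) := by
            intro y hy
            rw [edgeRel, edgeRel, hU]
            rintro c hc hcy
            rcases Sym2.mem_iff.1 hcy with rfl | rfl
            · exact hS _ hy hc.1
            · exact hc.2 rfl
          exact indicator_one_congr (and_congr (hE a List.mem_cons_self) (forall₂_congr fun y hy =>
            not_congr (hE y (List.mem_cons_of_mem a hy))))
        · have hE : ∀ y, ∀ c ∈ (S : Set ι) \ {x}, (edgeRel φ z U y c ↔ edgeRel φ z U' y c) := by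
            intro y c hc
            rw [edgeRel, edgeRel, hU]
            intro hn
            exact hn c hc (Sym2.mem_mk_right y c)
          rw [avoiding_congr (a :: h) hE, reachSet_congr x fun y c hc => hE y c hc.1]

/-! #### The mean cluster size of a finite configuration -/

open Classical in
/-- The mean size of the cluster of `v` in the random connection model on `v` and the points
of `s`. -/
noncomputable def clusterMean (φ : X → X → I) (v : X) (s : Multiset X) : ℝ≥0∞ :=
  meanReach φ (fun o : Option s.ToType => o.elim v fun x => x.1) (Set.range some) [] none

open Classical in
-- Over every position both sides have as many elements as its multiplicity, so the fibres can be
-- matched.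
theorem exists_equiv_toType (z : ι → X) (S : Finset ι) :
    ∃ e : (S.val.map z).ToType ≃ S, ∀ x, z (e x) = x.1 := by
  have h : ∀ c : X, Nonempty ({x : (S.val.map z).ToType // x.1 = c} ≃ {i : S // z i = c}) := by
    intro c
    refine Fintype.card_eq.1 ?_
    have h1 := congrArg (Multiset.count c) (Multiset.map_univ_coe (S.val.map z))
    rw [Multiset.count_map, Multiset.count_map] at h1
    rw [Fintype.card_subtype, Fintype.card_subtype]
    have h2 : (Finset.univ.filter fun i : S => z i = c).card
        = (Multiset.filter (fun i => c = z i) S.val).card := by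
      rw [← Finset.card_map (Function.Embedding.subtype _)]
      refine congrArg Multiset.card (?_ : _ = (S.filter fun i => c = z i).val)
      refine congrArg Finset.val ?_
      ext i
      simp [eq_comm, and_comm]
    rw [h2, ← h1]
    refine congrArg Multiset.card ?_
    rw [Finset.filter_val]
    exact Multiset.filter_congr fun x _ => eq_comm
  exact ⟨Equiv.ofFiberEquiv (f := fun x : (S.val.map z).ToType => x.1)
    (g := fun i : S => z i) fun c => (h c).some,
    fun x => Equiv.ofFiberEquiv_map (f := fun x : (S.val.map z).ToType => x.1)
      (g := fun i : S => z i) _ x⟩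

/-- The mean cluster size depends on a labelled configuration only through the multiset of
positions; this connects graphs on labels with functionals of point configurations. -/
theorem meanReach_eq_clusterMean [MeasurableSpace X] {φ : X → X → I}
    (hφ : Measurable fun p : X × X => φ p.1 p.2) (z : ι → X) {S : Finset ι} {a : ι} (ha : a ∉ S) :
    meanReach φ z S [] a = clusterMean φ (z a) (S.val.map z) := by
  classical
  obtain ⟨e, he⟩ := exists_equiv_toType z S
  let e' : Option (S.val.map z).ToType → ι := fun o => o.elim a fun x => (e x : ι)
  have he' : Function.Injective e' := by
    rintro (_ | x) (_ | y) hxy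
    · rfl
    · exact absurd ((e y).2) (by rwa [← (show a = e y from hxy)])
    · exact absurd ((e x).2) (by rwa [(show (e x : ι) = a from hxy)])
    · exact congrArg some (e.injective (Subtype.ext hxy))
  have hS : (S : Set ι) = e' '' Set.range some := by
    ext i
    simp only [Finset.mem_coe, Set.mem_image, Set.mem_range, exists_exists_eq_and]
    constructor
    · intro hi
      exact ⟨e.symm ⟨i, hi⟩, by simp [e']⟩
    · rintro ⟨x, rfl⟩
      exact (e x).2
  have hz : z ∘ e' = fun o : Option (S.val.map z).ToType => o.elim (z a) fun x => x.1 := by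
    ext o
    cases o with
    | none => rfl
    | some x => exact he x
  rw [hS, clusterMean, ← hz]
  refine meanReach_image φ z he' (fun T b => ?_) _ none
  simpa only [avoiding_nil] using measurable_encard_reachSet hφ (S := fun _ => T)
    (z := fun _ => z ∘ e') (U := fun U => U) (fun i => measurable_const)
    (fun e => measurable_pi_apply e) (fun i => MeasurableSet.const _) [] b

/-- Every configuration can be labelled. -/
theorem exists_labelling (v : X) (s t : Multiset X) : ∃ (ι : Type u) (_ : Finite ι) (z : ι → X)
    (S T : Finset ι) (a : ι), a ∉ T ∧ S ⊆ T ∧ z a = v ∧ S.val.map z = s ∧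
      T.val.map z = s + t := by
  classical
  refine ⟨Option (s.ToType ⊕ t.ToType), inferInstance,
    fun o => o.elim v (Sum.elim (fun x => x.1) fun x => x.1),
    Finset.univ.map (Function.Embedding.inl.trans Function.Embedding.some),
    Finset.univ.map Function.Embedding.some, none, by simp, ?_, rfl, ?_, ?_⟩
  · intro x
    simp only [Finset.mem_map]
    rintro ⟨y, _, rfl⟩
    exact ⟨_, Finset.mem_univ _, rfl⟩
  · simp [Function.comp_def]
  · rw [Finset.map_val, Multiset.map_map, ← Finset.univ_disjSum_univ]
    simp [Finset.disjSum, Multiset.disjSum, Function.comp_def]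

theorem clusterMean_mono [MeasurableSpace X] {φ : X → X → I}
    (hφ : Measurable fun p : X × X => φ p.1 p.2) (v : X) (s t : Multiset X) :
    clusterMean φ v s ≤ clusterMean φ v (s + t) := by
  obtain ⟨ι, _, z, S, T, a, ha, hST, rfl, rfl, hT⟩ := exists_labelling v s t
  rw [← hT, ← meanReach_eq_clusterMean hφ z ha,
    ← meanReach_eq_clusterMean hφ z fun h => ha (hST h)]
  exact meanReach_mono φ z (Finset.coe_subset.2 hST) [] a

/-- With one labelling and the same edge variables, the graphs before and after applying T coincide;
T need not be injective. -/
theorem clusterMean_map [MeasurableSpace X] {φ : X → X → I}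
    (hφ : Measurable fun p : X × X => φ p.1 p.2) {T : X → X} (hT : ∀ x y, φ (T x) (T y) = φ x y)
    (v : X) (s : Multiset X) : clusterMean φ (T v) (s.map T) = clusterMean φ v s := by
  obtain ⟨ι, _, z, S, _, a, ha, hST, rfl, rfl, _⟩ := exists_labelling v s 0
  have ha' : a ∉ S := fun h => ha (hST h)
  rw [Multiset.map_map, ← meanReach_eq_clusterMean hφ z ha',
    ← Function.comp_apply (f := T) (g := z), ← meanReach_eq_clusterMean hφ (T ∘ z) ha']
  have h : ∀ U, edgeRel φ (T ∘ z) U = edgeRel φ z U := fun U => by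
    ext x y
    simp only [edgeRel, Function.comp_apply, hT]
  simp only [meanReach, h]

theorem jMeasurable_clusterMean [MeasurableSpace X] {φ : X → X → I}
    (hφ : Measurable fun p : X × X => φ p.1 p.2) :
    JMeasurable fun (v : X) s => clusterMean φ v s := by
  intro m
  have h : ∀ p : X × (Fin m → X), clusterMean φ p.1 (List.ofFn p.2 : Multiset X)
      = meanReach φ (fun o : Option (Fin m) => o.elim p.1 p.2)
        (Finset.univ.map Function.Embedding.some : Finset (Option (Fin m))) [] none := by
    intro p
    rw [meanReach_eq_clusterMean hφ _ (by simp)]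
    congr 1
    rw [Finset.map_val, Multiset.map_map]
    exact (Fin.univ_val_map p.2).symm
  simp only [h, meanReach]
  refine Measurable.lintegral_prod_right
    (measurable_encard_reachSet hφ (fun o => ?_) (fun e => ?_) (fun i => MeasurableSet.const _) _ _)
  · cases o with
    | none => exact measurable_fst.comp measurable_fst
    | some i => exact (measurable_pi_apply i).comp (measurable_snd.comp measurable_fst)
  · exact (measurable_pi_apply e).comp measurable_snd

/-! #### The path expansion -/

/-- The expansion of the mean cluster size along the first steps of an induced path. -/
noncomputable def pathExpansion (φ : X → X → I) : ℕ → List X → X → Multiset X → ℝ≥0∞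
  | 0, _, v, s => clusterMean φ v s
  | k + 1, h, v, s =>
    1 + sumErase (fun x r => stepWeight φ h v x * pathExpansion φ k (v :: h) x r) s

/-- Iterates `meanReach_le`. At depth 0 the forbidden list is discarded, which only enlarges the
reachable set. -/
theorem meanReach_le_pathExpansion [MeasurableSpace X] {φ : X → X → I}
    (hφ : Measurable fun p : X × X => φ p.1 p.2) [Countable ι] (k : ℕ) (z : ι → X)
    {h : List ι} {S : Finset ι} {a : ι} (hh : (a :: h).Nodup) (hS : ∀ y ∈ a :: h, y ∉ S) :
    meanReach φ z S h a ≤ pathExpansion φ k (h.map z) (z a) (S.val.map z) := by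
  classical
  induction k generalizing h S a with
  | zero =>
    refine (meanReach_mono φ z subset_rfl h a).trans (le_of_eq ?_)
    exact meanReach_eq_clusterMean hφ z (hS a List.mem_cons_self)
  | succ k ih =>
    refine (meanReach_le hφ z hh hS).trans ((add_le_add_right
      (Finset.sum_le_sum fun x hx => mul_le_mul_right (ih (h := a :: h) (S := S.erase x) (a := x)
        (List.nodup_cons.2 ⟨fun hx' => hS x hx' hx, hh⟩) ?_) _) 1).trans (le_of_eq ?_))
    · intro y hy hyS
      rcases List.mem_cons.1 hy with rfl | hy
      · exact Finset.notMem_erase _ _ hyS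
      · exact hS y hy (Finset.mem_of_mem_erase hyS)
    · rw [pathExpansion, sumErase, Multiset.map_map]
      refine congrArg (1 + ·) (congrArg Multiset.sum (Multiset.map_congr rfl fun x hx => ?_))
      simp only [Function.comp_apply, List.map_cons]
      rw [← Multiset.map_erase_of_mem z S.val hx, Finset.erase_val]

theorem clusterMean_le_pathExpansion [MeasurableSpace X] {φ : X → X → I}
    (hφ : Measurable fun p : X × X => φ p.1 p.2) (k : ℕ) (v : X) (s : Multiset X) :
    clusterMean φ v s ≤ pathExpansion φ k [] v s := by
  obtain ⟨ι, _, z, S, _, a, ha, hST, rfl, rfl, _⟩ := exists_labelling v s 0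
  have ha' : a ∉ S := fun h => ha (hST h)
  rw [← meanReach_eq_clusterMean hφ z ha']
  have := Finite.to_countable (α := ι)
  exact meanReach_le_pathExpansion hφ k z (List.nodup_singleton a)
    (by simpa using ha')

theorem measurable_prob : Measurable prob :=
  ENNReal.measurable_ofReal.comp measurable_subtype_coe

theorem measurable_stepWeight [MeasurableSpace X] {φ : X → X → I}
    (hφ : Measurable fun p : X × X => φ p.1 p.2) {α : Type*} [MeasurableSpace α]
    {h : List (α → X)} (hh : ∀ g ∈ h, Measurable g) {v x : α → X} (hv : Measurable v)
    (hx : Measurable x) :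
    Measurable fun a => stepWeight φ (h.map fun g => g a) (v a) (x a) := by
  unfold stepWeight
  refine (measurable_prob.comp (hφ.comp (hv.prodMk hx))).mul ?_
  induction h with
  | nil => simp
  | cons g h ih =>
    simp only [List.map_cons, List.prod_cons]
    refine Measurable.mul ?_ (ih fun g' hg' => hh g' (List.mem_cons_of_mem g hg'))
    refine measurable_prob.comp (unitInterval.continuous_symm.measurable.comp ?_)
    exact hφ.comp ((hh g List.mem_cons_self).prodMk hx)

/-- The history is a list of measurable functions of a parameter, because every step of the
recursion adds the new point to the parameter space. -/
theorem jMeasurable_pathExpansion [MeasurableSpace X] {φ : X → X → I}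
    (hφ : Measurable fun p : X × X => φ p.1 p.2) (k : ℕ) {α : Type u} [MeasurableSpace α]
    {h : List (α → X)} (hh : ∀ g ∈ h, Measurable g) {v : α → X} (hv : Measurable v) :
    JMeasurable fun a s => pathExpansion φ k (h.map fun g => g a) (v a) s := by
  induction k generalizing α with
  | zero => exact (jMeasurable_clusterMean hφ).comp hv
  | succ k ih =>
    have hh' : ∀ g ∈ h.map fun g => fun p : α × X => g p.1, Measurable g := by
      intro g hg
      obtain ⟨g', hg', rfl⟩ := List.mem_map.1 hg
      exact (hh g' hg').comp measurable_fst
    have h1 := ih (α := α × X) (h := (fun p => v p.1) :: h.map fun g => fun p => g p.1)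
      (v := fun p => p.2) (by
        intro g hg
        rcases List.mem_cons.1 hg with rfl | hg
        · exact hv.comp measurable_fst
        · exact hh' g hg) measurable_snd
    have h2 := measurable_stepWeight hφ hh' (hv.comp measurable_fst) measurable_snd
    have h3 := ((h1.mul_left h2).sumErase).const_add 1
    simpa [List.map_map, Function.comp_def, pathExpansion] using h3

end RandomGraph

/-! ### The labelled realisation of the Poisson process -/

section Realisation

universe u

theorem exists_ofFn {ι : Type*} {X : Type u} (S : Finset ι) :
    ∃ (m : ℕ) (f : Fin m → ι), ∀ z : ι → X, S.val.map z = (List.ofFn (z ∘ f) : Multiset X) := by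
  refine ⟨S.toList.length, S.toList.get, fun z => ?_⟩
  rw [← List.map_ofFn, List.ofFn_get, ← Multiset.map_coe, Finset.coe_toList]

variable {ι Ω : Type*} {X : Type u} [MeasurableSpace X] [MeasurableSpace Ω]

theorem CMeasurable.measurable_map {F : Multiset X → ℝ≥0∞} (hF : CMeasurable F) (S : Finset ι)
    {z : Ω → ι → X} (hz : ∀ i, Measurable fun ω => z ω i) :
    Measurable fun ω => F (S.val.map (z ω)) := by
  obtain ⟨m, f, hf⟩ := exists_ofFn (X := X) S
  simp only [hf]
  exact (hF m).comp (measurable_pi_lambda _ fun i => hz (f i))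

theorem CMeasurable.measurable_map_add {F : Multiset X → ℝ≥0∞} (hF : CMeasurable F)
    (S T : Finset ι) {z w : Ω → ι → X} (hz : ∀ i, Measurable fun ω => z ω i)
    (hw : ∀ i, Measurable fun ω => w ω i) :
    Measurable fun ω => F (S.val.map (z ω) + T.val.map (w ω)) := by
  obtain ⟨m, f, hf⟩ := exists_ofFn (X := X) S
  obtain ⟨k, g, hg⟩ := exists_ofFn (X := X) T
  simp only [hf, hg]
  exact (hF.add m k).comp ((measurable_pi_lambda _ fun i => hz (f i)).prodMk
    (measurable_pi_lambda _ fun i => hw (g i)))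

theorem CMeasurable.add_right {F : Multiset X → ℝ≥0∞} (hF : CMeasurable F) (s : Multiset X) :
    CMeasurable fun r => F (r + s) := by
  intro m
  obtain ⟨l, rfl⟩ : ∃ l : List X, (l : Multiset X) = s := ⟨s.toList, s.coe_toList⟩
  have h := (hF.add m l.length).comp
    (measurable_id.prodMk (measurable_const (a := l.get)) :
      Measurable fun x : Fin m → X => (x, l.get))
  simpa [Function.comp_def] using h

theorem CMeasurable.poissonExp_add {F : Multiset X → ℝ≥0∞} (hF : CMeasurable F) (μ : Measure X)
    [IsFiniteMeasure μ] : CMeasurable fun s => poissonExp μ (fun r => F (r + s)) := by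
  intro m
  simp only [add_comm _ ((List.ofFn _ : List X) : Multiset X)]
  exact (hF.add m).measurable_poissonExp μ

/-- A function that factors through a countable space is measurable. -/
theorem measurable_of_factorsThrough {C : Type*} [Countable C] [MeasurableSpace C]
    [MeasurableSingletonClass C] {c : Ω → C} (hc : Measurable c) {f : Ω → ℝ≥0∞}
    (hf : Function.FactorsThrough f c) : Measurable f := by
  rw [← hf.extend_comp (fun _ => 0)]
  exact (measurable_of_countable _).comp hc

theorem lintegral_poissonMeasure (t : ℝ≥0) (μ : Measure X) [IsProbabilityMeasure μ]
    (F : Multiset X → ℝ≥0∞) :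
    ∫⁻ n, pointIntegral μ n F ∂poissonMeasure t = poissonExp (t • μ) F := by
  rw [lintegral_countable', poissonExp, ← ENNReal.tsum_mul_left]
  refine tsum_congr fun n => ?_
  have h1 : ((t • μ) Set.univ).toReal = t := by simp
  rw [poissonMeasure_singleton, pointIntegral_smul, h1, mul_div_assoc,
    ENNReal.ofReal_mul (Real.exp_pos _).le, ENNReal.ofReal_div_of_pos (by positivity),
    ENNReal.ofReal_natCast, ENNReal.ofReal_pow t.coe_nonneg, ENNReal.ofReal_coe_nnreal,
    ENNReal.div_eq_inv_mul]
  ring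

/-- Independent points form a configuration with the product law. -/
theorem lintegral_infinitePi_range {Y : Type u} [MeasurableSpace Y] (ν : Measure Y)
    [IsProbabilityMeasure ν] {T : Y → X} (hT : Measurable T) (n : ℕ) {F : Multiset X → ℝ≥0∞}
    (hF : CMeasurable F) :
    ∫⁻ ω, F ((Finset.range n).val.map fun i => T (ω i)) ∂(Measure.infinitePi fun _ : ℕ => ν)
      = pointIntegral (ν.map T) n F := by
  have hTi : ∀ i : ℕ, Measurable fun ω : ℕ → Y => T (ω i) :=
    fun i => hT.comp (measurable_pi_apply i)
  have : IsProbabilityMeasure (ν.map T) := Measure.isProbabilityMeasure_map hT.aemeasurable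
  induction n generalizing F with
  | zero => simp [pointIntegral]
  | succ n ih =>
    have h : ∀ ω : ℕ → Y, F ((Finset.range (n + 1)).val.map fun i => T (ω i))
        = F ((({n} : Finset ℕ).val.map fun i => T (ω i))
          + (Finset.range n).val.map fun i => T (ω i)) := by
      intro ω
      simp [Multiset.range_succ]
    simp only [h]
    -- The point with label n is independent of those with smaller labels and becomes the outer
    -- integration variable.
    rw [lintegral_infinitePi_resample ν {n}ᶜ (f := fun ω ω' =>
      F ((({n} : Finset ℕ).val.map fun i => T (ω' i)) + (Finset.range n).val.map fun i => T (ω i)))]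
    · simp only [Finset.singleton_val, Multiset.map_singleton, Multiset.singleton_add]
      rw [pointIntegral, lintegral_map (hF.cons.measurable_pointIntegral _ n) hT]
      refine Eq.trans (lintegral_congr fun ω' => ih (hF.cons.cMeasurable (T (ω' n)))) ?_
      exact (measurePreserving_eval_infinitePi (fun _ : ℕ => ν) n).lintegral_comp
        ((hF.cons.measurable_pointIntegral _ n).comp hT)
    · exact hF.measurable_map_add _ _ (fun i => (hTi i).comp measurable_snd)
        (fun i => (hTi i).comp measurable_fst)
    · intro ω ω' ω'' hω
      congr 2
      refine Multiset.map_congr rfl fun i hi => ?_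
      rw [hω i (by simpa using (Finset.mem_range.1 hi).ne)]
    · intro ω ω' ω'' hω
      congr 2
      refine Multiset.map_congr rfl fun i hi => ?_
      rw [hω i (by simpa using hi)]

end Realisation

/-! ### Poisson points in finitely many cubes -/

section Configuration

universe u

variable {d : ℕ} {M : Type u}

/-- The marked point with a relative location in the cube of `k`. -/
def cubePoint (k : Fin d → ℤ) (y : (Fin d → I) × M) : Pt d M :=
  (fun j => (k j : ℝ) + (y.1 j : ℝ), y.2)

/-- The labels of the points present in the cubes of `Λ`. -/
def presentLabels (Λ : Finset (Fin d → ℤ)) (N : (Fin d → ℤ) → ℕ) : Finset (Label d) :=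
  Λ.biUnion fun k => (Finset.range (N k)).map ⟨Prod.mk k, Prod.mk_right_injective k⟩

theorem mem_presentLabels {Λ : Finset (Fin d → ℤ)} {N : (Fin d → ℤ) → ℕ} {a : Label d} :
    a ∈ presentLabels Λ N ↔ a.1 ∈ Λ ∧ a.2 < N a.1 := by
  obtain ⟨k, i⟩ := a
  simp only [presentLabels, Finset.mem_biUnion, Finset.mem_map, Finset.mem_range,
    Function.Embedding.coeFn_mk, Prod.mk.injEq]
  grind

theorem presentLabels_congr {Λ : Finset (Fin d → ℤ)} {N N' : (Fin d → ℤ) → ℕ}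
    (h : ∀ k ∈ Λ, N k = N' k) : presentLabels Λ N = presentLabels Λ N' := by
  ext a
  rw [mem_presentLabels, mem_presentLabels]
  refine and_congr_right fun ha => ?_
  rw [h _ ha]

theorem presentLabels_insert {Λ : Finset (Fin d → ℤ)} {k : Fin d → ℤ} (hk : k ∉ Λ)
    (N : (Fin d → ℤ) → ℕ) : (presentLabels (insert k Λ) N).val
      = (presentLabels {k} N).val + (presentLabels Λ N).val := by
  have h : Disjoint (presentLabels {k} N) (presentLabels Λ N) := by
    rw [Finset.disjoint_left]
    intro a ha hb
    rw [mem_presentLabels, Finset.mem_singleton] at ha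
    exact hk (ha.1 ▸ (mem_presentLabels.1 hb).1)
  rw [← Finset.disjUnion_val _ _ h]
  congr 1
  ext a
  simp only [mem_presentLabels, Finset.mem_disjUnion, Finset.mem_insert, Finset.mem_singleton]
  tauto

/-- The configuration of the points in the cubes of `Λ`. -/
def config (Λ : Finset (Fin d → ℤ)) (N : (Fin d → ℤ) → ℕ) (ω : Label d → (Fin d → I) × M) :
    Multiset (Pt d M) :=
  (presentLabels Λ N).val.map fun a => cubePoint a.1 (ω a)

theorem config_insert {Λ : Finset (Fin d → ℤ)} {k : Fin d → ℤ} (hk : k ∉ Λ)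
    (N : (Fin d → ℤ) → ℕ) (ω : Label d → (Fin d → I) × M) :
    config (insert k Λ) N ω = config {k} N ω + config Λ N ω := by
  rw [config, presentLabels_insert hk, Multiset.map_add]
  rfl

theorem config_congr {Λ : Finset (Fin d → ℤ)} {N N' : (Fin d → ℤ) → ℕ}
    (h : ∀ k ∈ Λ, N k = N' k) {ω ω' : Label d → (Fin d → I) × M}
    (hω : ∀ a : Label d, a.1 ∈ Λ → ω a = ω' a) : config Λ N ω = config Λ N' ω' := by
  rw [config, config, presentLabels_congr h]
  refine Multiset.map_congr rfl fun a ha => ?_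
  rw [hω a (mem_presentLabels.1 ha).1]

variable [MeasurableSpace M]

theorem measurable_cubePoint (k : Fin d → ℤ) :
    Measurable (cubePoint k : (Fin d → I) × M → Pt d M) := by
  unfold cubePoint
  refine (measurable_pi_lambda _ fun j => ?_).prodMk measurable_snd
  exact measurable_const.add (measurable_subtype_coe.comp
    ((measurable_pi_apply j).comp measurable_fst))

variable (Q : Measure M) [IsProbabilityMeasure Q]

/-- The law of a uniform point of the cube of `k` with a random mark. -/
noncomputable def cubeMeasure (k : Fin d → ℤ) : Measure (Pt d M) :=
  ((volume : Measure (Fin d → I)).prod Q).map (cubePoint k)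

instance (k : Fin d → ℤ) : IsProbabilityMeasure (cubeMeasure Q k) :=
  Measure.isProbabilityMeasure_map (measurable_cubePoint k).aemeasurable

theorem lintegral_config_singleton (k : Fin d → ℤ) (N : (Fin d → ℤ) → ℕ)
    {F : Multiset (Pt d M) → ℝ≥0∞} (hF : CMeasurable F) :
    ∫⁻ ω, F (config {k} N ω)
      ∂(Measure.infinitePi fun _ : Label d => (volume : Measure (Fin d → I)).prod Q)
      = pointIntegral (cubeMeasure Q k) (N k) F := by
  have h : ∀ ω : Label d → (Fin d → I) × M, config {k} N ω
      = (Finset.range (N k)).val.map fun i => cubePoint k ((ω ∘ Prod.mk k) i) := by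
    intro ω
    rw [config, presentLabels, Finset.singleton_biUnion, Finset.map_val, Multiset.map_map]
    rfl
  simp only [h]
  rw [(measurePreserving_comp_injective ((volume : Measure (Fin d → I)).prod Q)
    (Prod.mk_right_injective k)).lintegral_comp (f := fun ω =>
      F ((Finset.range (N k)).val.map fun i => cubePoint k (ω i)))]
  · exact lintegral_infinitePi_range _ (measurable_cubePoint k) (N k) hF
  · exact hF.measurable_map _ fun i => (measurable_cubePoint k).comp (measurable_pi_apply i)

/-- The points in the cubes of `Λ` form a Poisson process. -/
theorem lintegral_config (t : ℝ≥0) (Λ : Finset (Fin d → ℤ)) {F : Multiset (Pt d M) → ℝ≥0∞}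
    (hF : CMeasurable F) :
    ∫⁻ N, ∫⁻ ω, F (config Λ N ω)
        ∂(Measure.infinitePi fun _ : Label d => (volume : Measure (Fin d → I)).prod Q)
        ∂(Measure.infinitePi fun _ : Fin d → ℤ => poissonMeasure t)
      = poissonExp (t • ∑ k ∈ Λ, cubeMeasure Q k) F := by
  classical
  have hpos : ∀ a : Label d, Measurable fun ω : Label d → (Fin d → I) × M => cubePoint a.1 (ω a) :=
    fun a => (measurable_cubePoint a.1).comp (measurable_pi_apply a)
  induction Λ using Finset.induction_on generalizing F with
  | empty =>
    have h : ∀ N ω, config (∅ : Finset (Fin d → ℤ)) N ω = (0 : Multiset (Pt d M)) :=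
      fun N ω => rfl
    simp only [h]
    simp only [lintegral_const, measure_univ, mul_one, Finset.sum_empty, smul_zero]
    rw [poissonExp, tsum_eq_single 0]
    · simp [pointIntegral]
    · intro n hn
      obtain ⟨n, rfl⟩ := Nat.exists_eq_succ_of_ne_zero hn
      simp [pointIntegral]
  | insert k Λ hk ih =>
    set ν := (volume : Measure (Fin d → I)).prod Q with hν
    have hfin : IsFiniteMeasure (t • ∑ k ∈ Λ, cubeMeasure Q k) := by infer_instance
    have hXX : ∀ N N' : (Fin d → ℤ) → ℕ, Measurable (Function.uncurry
        fun (ω ω' : Label d → (Fin d → I) × M) => F (config {k} N' ω' + config Λ N ω)) :=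
      fun N N' => hF.measurable_map_add (presentLabels {k} N') (presentLabels Λ N)
        (z := fun (p : (Label d → (Fin d → I) × M) × (Label d → (Fin d → I) × M)) a =>
          cubePoint a.1 (p.2 a))
        (w := fun (p : (Label d → (Fin d → I) × M) × (Label d → (Fin d → I) × M)) a =>
          cubePoint a.1 (p.1 a))
        (fun a => (hpos a).comp measurable_snd) (fun a => (hpos a).comp measurable_fst)
    have h1 : ∀ N, ∫⁻ ω, F (config (insert k Λ) N ω) ∂(Measure.infinitePi fun _ : Label d => ν)
        = ∫⁻ ω, pointIntegral (cubeMeasure Q k) (N k) (fun r => F (r + config Λ N ω))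
          ∂(Measure.infinitePi fun _ : Label d => ν) := by
      intro N
      simp only [config_insert hk]
      -- For fixed counts, the points of the cube of k are independent of those of the other cubes.
      rw [lintegral_infinitePi_resample ν {a : Label d | a.1 = k}
        (f := fun ω' ω => F (config {k} N ω' + config Λ N ω))]
      · exact lintegral_congr fun ω =>
          lintegral_config_singleton Q k N (hF.add_right (config Λ N ω))
      · exact (hXX N N).comp measurable_swap
      · intro ω ω' ω'' h
        rw [config_congr (fun _ _ => rfl) fun a ha => h a (Finset.mem_singleton.1 ha)]
      · intro ω ω' ω'' h
        rw [config_congr (Λ := Λ) (fun _ _ => rfl) fun a ha => h a ?_]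
        rintro rfl
        exact hk ha
    simp only [h1]
    -- The count of the cube of k is independent of the counts in Λ; averaging over it turns
    -- `pointIntegral` into `poissonExp`.
    rw [lintegral_infinitePi_resample (poissonMeasure t) {k} (f := fun N' N =>
      ∫⁻ ω, pointIntegral (cubeMeasure Q k) (N' k) (fun r => F (r + config Λ N ω))
          ∂(Measure.infinitePi fun _ : Label d => ν))]
    · have h2 : ∀ N : (Fin d → ℤ) → ℕ, ∫⁻ N' : (Fin d → ℤ) → ℕ,
          ∫⁻ ω, pointIntegral (cubeMeasure Q k) (N' k) (fun r => F (r + config Λ N ω))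
            ∂(Measure.infinitePi fun _ : Label d => ν)
            ∂(Measure.infinitePi fun _ : Fin d → ℤ => poissonMeasure t)
          = ∫⁻ ω, poissonExp (t • cubeMeasure Q k) (fun r => F (r + config Λ N ω))
            ∂(Measure.infinitePi fun _ : Label d => ν) := by
        intro N
        rw [(measurePreserving_eval_infinitePi (fun _ : Fin d → ℤ => poissonMeasure t)
          k).lintegral_comp (f := fun n => ∫⁻ ω, pointIntegral (cubeMeasure Q k) n
            (fun r => F (r + config Λ N ω)) ∂(Measure.infinitePi fun _ : Label d => ν))
            (measurable_of_countable _), lintegral_countable']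
        have hm : ∀ n : ℕ, Measurable fun ω => pointIntegral (cubeMeasure Q k) n
            (fun r => F (r + config Λ N ω)) * poissonMeasure t {n} := by
          intro n
          obtain ⟨m, f, hf⟩ := exists_ofFn (X := Pt d M) (presentLabels Λ N)
          simp only [config, hf, add_comm _ ((List.ofFn _ : List (Pt d M)) : Multiset (Pt d M))]
          exact (((hF.add m).measurable_pointIntegral _ n).comp
            (measurable_pi_lambda _ fun i => hpos (f i))).mul_const _
        simp_rw [← lintegral_poissonMeasure, lintegral_countable']
        rw [lintegral_tsum fun n => (hm n).aemeasurable]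
        refine tsum_congr fun n => ?_
        rw [lintegral_mul_const']
        exact measure_ne_top _ _
      simp only [h2]
      rw [ih (hF.poissonExp_add _), Finset.sum_insert hk, smul_add, add_comm,
        poissonExp_add_measure _ _ hF]
      simp only [add_comm]
    -- Only finitely many integer counts enter, so the function factors through a countable discrete
    -- space.
    · refine measurable_of_factorsThrough
        (c := fun p : ((Fin d → ℤ) → ℕ) × ((Fin d → ℤ) → ℕ) =>
          (p.1 k, fun l : Λ => p.2 l)) ?_ ?_
      · refine ((measurable_pi_apply k).comp measurable_fst).prodMk
          (measurable_pi_lambda _ fun l => (measurable_pi_apply _).comp measurable_snd)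
      · rintro ⟨N', N⟩ ⟨L', L⟩ h
        obtain ⟨ha, hb⟩ := Prod.mk.inj h
        have hb' : ∀ l ∈ Λ, N l = L l := fun l hl => congrFun hb ⟨l, hl⟩
        simp only [Function.uncurry] at ha ⊢
        rw [ha]
        simp only [config_congr (N := N) (N' := L) hb' (fun _ _ => rfl)]
    · intro N N' N'' h
      simp only [h k rfl]
    · intro N N' N'' h
      have hb' : ∀ l ∈ Λ, N l = N' l := fun l hl => h l (by rintro rfl; exact hk hl)
      simp only [config_congr (N := N) (N' := N') hb' (fun _ _ => rfl)]

end Configuration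

section Boxes

universe u

variable {d : ℕ} {M : Type u} [MeasurableSpace M] (Q : Measure M) [IsProbabilityMeasure Q]

/-! ### The intensity measure on large boxes -/

theorem map_add_volume_unitInterval (k : ℤ) :
    (volume : Measure I).map (fun u : I => (k : ℝ) + (u : ℝ))
      = (volume : Measure ℝ).restrict (Set.Ico (k : ℝ) (k + 1)) := by
  have h1 : (volume : Measure I).map (Subtype.val : I → ℝ)
      = (volume : Measure ℝ).restrict (Set.Icc 0 1) :=
    map_comap_subtype_coe measurableSet_Icc volume
  have h2 : (fun u : I => (k : ℝ) + (u : ℝ)) = (fun x : ℝ => (k : ℝ) + x) ∘ Subtype.val := rfl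
  rw [h2, ← Measure.map_map (measurable_const_add _) measurable_subtype_coe, h1]
  have h3 : Set.Icc (0 : ℝ) 1 = (fun x : ℝ => (k : ℝ) + x) ⁻¹' Set.Icc (k : ℝ) (k + 1) := by
    ext x
    simp
  rw [h3, ((measurePreserving_add_left volume (k : ℝ)).restrict_preimage
    measurableSet_Icc).map_eq]
  -- The end point is a null set; half-open intervals make the cubes disjoint.
  exact Measure.restrict_congr_set Ico_ae_eq_Icc.symm

/-- The marked points in the half-open unit cube of `k`. -/
def cube (M : Type*) (k : Fin d → ℤ) : Set (Pt d M) := {p | ∀ j, ⌊p.1 j⌋ = k j}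

theorem measurableSet_cube (k : Fin d → ℤ) : MeasurableSet (cube M k) := by
  have : cube M k = ⋂ j, {p : Pt d M | ⌊p.1 j⌋ = k j} := by
    ext p
    simp [cube]
  rw [this]
  refine MeasurableSet.iInter fun j => ?_
  exact ((Int.measurable_floor.comp ((measurable_pi_apply j).comp measurable_fst)))
    (measurableSet_singleton (k j))

theorem cubeMeasure_eq (k : Fin d → ℤ) :
    cubeMeasure Q k = (refMeasure d Q).restrict (cube M k) := by
  have h1 : (cubePoint k : (Fin d → I) × M → Pt d M)
      = Prod.map (fun (x : Fin d → I) j => (k j : ℝ) + (x j : ℝ)) id := rfl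
  have hm : ∀ j, Measurable fun u : I => (k j : ℝ) + (u : ℝ) :=
    fun j => measurable_const.add measurable_subtype_coe
  have h2 : (volume : Measure (Fin d → I)).map (fun (x : Fin d → I) j => (k j : ℝ) + (x j : ℝ))
      = (volume : Measure (Fin d → ℝ)).restrict
        (Set.univ.pi fun j => Set.Ico (k j : ℝ) (k j + 1)) := by
    rw [volume_pi, volume_pi, Measure.restrict_pi_pi]
    simp only [← map_add_volume_unitInterval]
    have : ∀ j, IsProbabilityMeasure ((volume : Measure I).map fun u : I => (k j : ℝ) + (u : ℝ)) :=
      fun j => Measure.isProbabilityMeasure_map (hm j).aemeasurable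
    exact Measure.pi_map_pi fun j => (hm j).aemeasurable
  have h3 : cube M k = (Set.univ.pi fun j => Set.Ico (k j : ℝ) (k j + 1)) ×ˢ Set.univ := by
    ext p
    simp [cube, Int.floor_eq_iff]
  have h4 : Measurable fun (x : Fin d → I) j => (k j : ℝ) + (x j : ℝ) :=
    measurable_pi_lambda _ fun j => (hm j).comp (measurable_pi_apply j)
  rw [cubeMeasure, h1, ← Measure.map_prod_map _ _ h4 measurable_id, h2, Measure.map_id, h3,
    refMeasure, ← Measure.prod_restrict, Measure.restrict_univ]

/-- The indices of the unit cubes of a large box. -/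
noncomputable def boxIndex (d m : ℕ) : Finset (Fin d → ℤ) :=
  Fintype.piFinset fun _ => Finset.Icc (-(m : ℤ)) m

theorem boxIndex_mono {m n : ℕ} (h : m ≤ n) : boxIndex d m ⊆ boxIndex d n :=
  Fintype.piFinset_subset _ _ fun _ => Finset.Icc_subset_Icc (by omega) (by omega)

/-- The marked points in a large box. -/
def box (d : ℕ) (M : Type*) (m : ℕ) : Set (Pt d M) := {p | ∀ j, ⌊p.1 j⌋ ∈ Finset.Icc (-(m : ℤ)) m}

omit [MeasurableSpace M] in
theorem box_eq_biUnion (m : ℕ) : box d M m = ⋃ k ∈ boxIndex d m, cube M k := by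
  ext p
  simp only [box, cube, boxIndex, Set.mem_iUnion, Fintype.mem_piFinset, exists_prop,
    Set.mem_ofPred_eq]
  constructor
  · exact fun h => ⟨fun j => ⌊p.1 j⌋, h, fun j => rfl⟩
  · rintro ⟨k, hk, h⟩ j
    rw [h j]
    exact hk j

theorem measurableSet_box (m : ℕ) : MeasurableSet (box d M m) := by
  rw [box_eq_biUnion]
  exact Finset.measurableSet_biUnion _ fun k _ => measurableSet_cube k

theorem sum_cubeMeasure (m : ℕ) :
    ∑ k ∈ boxIndex d m, cubeMeasure Q k = (refMeasure d Q).restrict (box d M m) := by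
  ext A hA
  rw [Measure.finsetSum_apply, Measure.restrict_apply hA, box_eq_biUnion, Set.inter_iUnion₂,
    measure_biUnion_finset]
  · simp only [cubeMeasure_eq, Measure.restrict_apply hA]
  · intro k _ l _ hkl
    rw [Function.onFun, Set.disjoint_left]
    rintro p ⟨_, hp⟩ ⟨_, hp'⟩
    exact hkl (funext fun j => (hp j).symm.trans (hp' j))
  · exact fun k _ => hA.inter (measurableSet_cube k)

instance (m : ℕ) : IsFiniteMeasure ((refMeasure d Q).restrict (box d M m)) := by
  rw [← sum_cubeMeasure]
  infer_instance

theorem isFiniteMeasure_restrict_of_subset_box {B : Set (Pt d M)} {m : ℕ} (hB : B ⊆ box d M m) :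
    IsFiniteMeasure ((refMeasure d Q).restrict B) :=
  ⟨(Measure.restrict_mono_set _ hB Set.univ).trans_lt (measure_lt_top _ _)⟩

/-! ### The mean cluster size as a limit over boxes -/

variable {φ : Pt d M → Pt d M → I} (hφ : IsConnectionFunction φ)

/-- The positions of the vertices of the augmented model. -/
def vertexPosition (v : Pt d M) (ω : Label d → (Fin d → I) × M) (o : VLabel d) : Pt d M :=
  o.elim v fun a => cubePoint a.1 (ω a)

omit [MeasurableSpace M] in
theorem position_eq (v : Pt d M) (ω : Sample d M) : position v ω = vertexPosition v ω.2.1 := by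
  ext o
  · cases o <;> rfl
  · cases o <;> rfl

/-- The labels of the Poisson points in a large box. -/
noncomputable def boxLabels (m : ℕ) (N : (Fin d → ℤ) → ℕ) : Finset (VLabel d) :=
  (presentLabels (boxIndex d m) N).map Function.Embedding.some

theorem some_mem_boxLabels {m : ℕ} {N : (Fin d → ℤ) → ℕ} {a : Label d} :
    some a ∈ boxLabels m N ↔ a.1 ∈ boxIndex d m ∧ a.2 < N a.1 := by
  simp [boxLabels, mem_presentLabels]

theorem none_notMem_boxLabels {m : ℕ} {N : (Fin d → ℤ) → ℕ} : none ∉ boxLabels m N := by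
  simp [boxLabels]

theorem exists_mem_boxIndex (k : Fin d → ℤ) : ∃ m, k ∈ boxIndex d m := by
  refine ⟨Finset.univ.sup fun j => (k j).natAbs, ?_⟩
  rw [boxIndex, Fintype.mem_piFinset]
  intro j
  have : (k j).natAbs ≤ Finset.univ.sup fun j => (k j).natAbs :=
    Finset.le_sup (f := fun j => (k j).natAbs) (Finset.mem_univ j)
  rw [Finset.mem_Icc]
  omega

theorem monotone_boxLabels (N : (Fin d → ℤ) → ℕ) :
    Monotone fun m => ((boxLabels m N : Finset (VLabel d)) : Set (VLabel d)) := by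
  intro m n hmn o ho
  cases o with
  | none => exact absurd ho none_notMem_boxLabels
  | some a =>
    have := some_mem_boxLabels.1 (Finset.mem_coe.1 ho)
    exact Finset.mem_coe.2 (some_mem_boxLabels.2 ⟨boxIndex_mono hmn this.1, this.2⟩)

omit [MeasurableSpace M] in
theorem cluster_eq (hs : ∀ z w, φ z w = φ w z) (v : Pt d M) (ω : Sample d M) :
    cluster φ hs v ω = ⋃ m, reachSet (edgeRel φ (vertexPosition v ω.2.1) ω.2.2)
      (boxLabels m ω.1) none := by
  rw [← reachSet_iUnion (monotone_boxLabels ω.1)]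
  have hU : ∀ o : VLabel d, o ∈ ⋃ m, ((boxLabels m ω.1 : Finset (VLabel d)) : Set (VLabel d)) ↔
      ∃ a, o = some a ∧ a.2 < ω.1 a.1 := by
    intro o
    cases o with
    | none => simp [none_notMem_boxLabels]
    | some a =>
      simp only [Set.mem_iUnion, Finset.mem_coe, some_mem_boxLabels, exists_and_right,
        exists_mem_boxIndex, true_and]
      simp
  have hP : ∀ o : VLabel d, o ∈ ⋃ m, ((boxLabels m ω.1 : Finset (VLabel d)) : Set (VLabel d)) →
      IsPresent ω o := by
    intro o ho
    obtain ⟨a, rfl, ha⟩ := (hU o).1 ho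
    exact ha
  ext b
  simp only [cluster, Set.mem_ofPred_eq, SimpleGraph.reachable_iff_reflTransGen]
  constructor
  · intro h
    induction h with
    | refl => exact Relation.ReflTransGen.refl
    | @tail b c _ hbc ih =>
      cases c with
      -- A return to the added vertex is cut off by starting the path afresh.
      | none => exact Relation.ReflTransGen.refl
      | some c =>
        refine Relation.ReflTransGen.tail ih ⟨(hU _).2 ⟨c, rfl, hbc.2.2.1⟩, ?_⟩
        rw [edgeRel, ← position_eq]
        exact hbc.2.2.2
  · intro h
    have : (graph φ hs v ω).Reachable none b ∧ IsPresent ω b := by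
      induction h with
      | refl => exact ⟨SimpleGraph.Reachable.refl _, trivial⟩
      | @tail b c _ hbc ih =>
        refine ⟨?_, hP c hbc.1⟩
        -- `edgeRel` may contain loops, which `graph` excludes; a loop is simply skipped.
        by_cases hne : b = c
        · exact hne ▸ ih.1
        · refine ih.1.trans (SimpleGraph.Adj.reachable ⟨hne, ih.2, hP c hbc.1, ?_⟩)
          rw [position_eq]
          exact hbc.2
    exact (SimpleGraph.reachable_iff_reflTransGen _ _).1 this.1

include hφ in
-- Monotone convergence along growing boxes. Within a box, integrating out the edges gives
-- `clusterMean` of the configuration, and `lintegral_config` identifies the law of the latter.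
theorem meanCluster_eq_iSup (t : ℝ≥0) (v : Pt d M) :
    meanCluster Q φ hφ.symm t v
      = ⨆ m, poissonExp (t • (refMeasure d Q).restrict (box d M m)) (clusterMean φ v) := by
  have hpos : ∀ o : VLabel d, Measurable fun ω : Label d → (Fin d → I) × M =>
      vertexPosition v ω o := by
    intro o
    cases o with
    | none => exact measurable_const
    | some a => exact (measurable_cubePoint a.1).comp (measurable_pi_apply a)
  have hm : ∀ m, Measurable fun ω : Sample d M =>
      (((reachSet (edgeRel φ (vertexPosition v ω.2.1) ω.2.2)
        (boxLabels m ω.1) none).encard : ℕ∞) : ℝ≥0∞) := by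
    intro m
    have := measurable_encard_reachSet hφ.measurable (Ω := Sample d M)
      (z := fun ω => vertexPosition v ω.2.1) (U := fun ω => ω.2.2)
      (S := fun ω => (boxLabels m ω.1 : Finset (VLabel d)))
      (fun o => (hpos o).comp (measurable_fst.comp measurable_snd))
      (fun e => (measurable_pi_apply e).comp (measurable_snd.comp measurable_snd))
      (fun o => ?_) [] none
    · simpa only [avoiding_nil] using this
    · cases o with
      | none => simp [none_notMem_boxLabels]
      | some a =>
        simp only [Finset.mem_coe, some_mem_boxLabels]
        exact (MeasurableSet.const _).inter (measurableSet_lt measurable_const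
          ((measurable_pi_apply a.1).comp measurable_fst))
  have hmono : ∀ ω : Sample d M, Monotone fun m =>
      reachSet (edgeRel φ (vertexPosition v ω.2.1) ω.2.2) (boxLabels m ω.1) none :=
    fun ω m n hmn => reachSet_mono none fun x y hy hr => ⟨monotone_boxLabels ω.1 hmn hy, hr⟩
  simp only [meanCluster, cluster_eq]
  simp_rw [encard_iUnion_eq_iSup (hmono _)]
  rw [lintegral_iSup hm fun m n hmn ω => ENat.toENNReal_mono (Set.encard_le_encard (hmono ω hmn))]
  refine iSup_congr fun m => ?_
  rw [← sum_cubeMeasure, ← lintegral_config Q t (boxIndex d m)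
    ((jMeasurable_clusterMean hφ.measurable).cMeasurable v), law,
    lintegral_prod _ (hm m).aemeasurable]
  refine lintegral_congr fun N => ?_
  refine (lintegral_prod _ ((hm m).comp measurable_prodMk_left).aemeasurable).trans ?_
  refine lintegral_congr fun ω => ?_
  have h := meanReach_eq_clusterMean hφ.measurable (vertexPosition v ω)
    (none_notMem_boxLabels (m := m) (N := N))
  have h2 : (boxLabels m N).val.map (vertexPosition v ω) = config (boxIndex d m) N ω := by
    rw [boxLabels, Finset.map_val, Multiset.map_map]
    rfl
  rw [h2] at h
  refine Eq.trans ?_ h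
  rw [meanReach, edgeLaw]
  simp only [avoiding_nil]
  rfl

omit [IsProbabilityMeasure Q] in
theorem smul_restrict_mono {t t' : ℝ≥0} (htt' : t ≤ t') {B B' : Set (Pt d M)} (hB : B ⊆ B') :
    t • (refMeasure d Q).restrict B ≤ t' • (refMeasure d Q).restrict B' := by
  intro A
  simp only [Measure.smul_apply, ENNReal.smul_def, smul_eq_mul]
  exact mul_le_mul' (by exact_mod_cast htt') (Measure.restrict_mono_set _ hB A)

include hφ in
theorem poissonExp_le_meanCluster (t : ℝ≥0) (v : Pt d M) {B : Set (Pt d M)} {m : ℕ}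
    (hB : B ⊆ box d M m) :
    poissonExp (t • (refMeasure d Q).restrict B) (clusterMean φ v)
      ≤ meanCluster Q φ hφ.symm t v := by
  have := isFiniteMeasure_restrict_of_subset_box Q hB
  rw [meanCluster_eq_iSup Q hφ]
  exact (poissonExp_mono_measure _ _
    ((jMeasurable_clusterMean hφ.measurable).cMeasurable v) (clusterMean_mono hφ.measurable v)
    (smul_restrict_mono Q le_rfl hB)).trans (le_iSup (fun m =>
      poissonExp (t • (refMeasure d Q).restrict (box d M m)) (clusterMean φ v)) m)

include hφ in
theorem meanCluster_mono {t t' : ℝ≥0} (h : t ≤ t') (v : Pt d M) :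
    meanCluster Q φ hφ.symm t v ≤ meanCluster Q φ hφ.symm t' v := by
  rw [meanCluster_eq_iSup Q hφ, meanCluster_eq_iSup Q hφ]
  exact iSup_mono fun m => poissonExp_mono_measure _ _
    ((jMeasurable_clusterMean hφ.measurable).cMeasurable v) (clusterMean_mono hφ.measurable v)
    (smul_restrict_mono Q h subset_rfl)

include hφ in
theorem measurable_meanCluster (t : ℝ≥0) : Measurable (meanCluster Q φ hφ.symm t) := by
  have : meanCluster Q φ hφ.symm t = fun v => ⨆ m,
      poissonExp (t • (refMeasure d Q).restrict (box d M m)) (clusterMean φ v) :=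
    funext fun v => meanCluster_eq_iSup Q hφ t v
  rw [this]
  exact Measurable.iSup fun m =>
    (jMeasurable_clusterMean hφ.measurable).measurable_poissonExp _

/-! ### Translation invariance -/

/-- The translation of the locations by `x`. -/
def shift (x : Fin d → ℝ) (p : Pt d M) : Pt d M := (p.1 + x, p.2)

theorem measurePreserving_shift (x : Fin d → ℝ) :
    MeasurePreserving (shift x) (refMeasure d Q) (refMeasure d Q) :=
  (measurePreserving_add_right volume x).prod (MeasurePreserving.id Q)

include hφ in
omit [IsProbabilityMeasure Q] in
theorem connection_shift (x : Fin d → ℝ) (p q : Pt d M) : φ (shift x p) (shift x q) = φ p q := by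
  obtain ⟨y, p⟩ := p
  obtain ⟨w, q⟩ := q
  rw [hφ.translation y w p q, shift, shift, hφ.translation]
  simp

omit [MeasurableSpace M] in
theorem exists_preimage_shift_subset_box (x : Fin d → ℝ) (m : ℕ) :
    ∃ n, shift x ⁻¹' box d M m ⊆ box d M n := by
  obtain ⟨C, hC⟩ := exists_nat_ge ‖x‖
  refine ⟨m + 1 + C, fun p hp j => ?_⟩
  have h1 := hp j
  have h2 : |x j| ≤ C := (Real.norm_eq_abs (x j) ▸ norm_le_pi_norm x j).trans hC
  rw [abs_le] at h2
  simp only [shift, Pi.add_apply, Finset.mem_Icc, Int.le_floor, Int.floor_le_iff] at h1 ⊢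
  push_cast at h1 ⊢
  constructor <;> linarith [h1.1, h1.2, h2.1, h2.2]

include hφ in
-- A box is not invariant, but its preimage under the shift lies in a larger box. An inequality
-- suffices, since the shift by -x gives the converse.
theorem meanCluster_shift_le (t : ℝ≥0) (x : Fin d → ℝ) (v : Pt d M) :
    meanCluster Q φ hφ.symm t (shift x v) ≤ meanCluster Q φ hφ.symm t v := by
  rw [meanCluster_eq_iSup Q hφ]
  refine iSup_le fun m => ?_
  obtain ⟨n, hn⟩ := exists_preimage_shift_subset_box (M := M) x m
  have := isFiniteMeasure_restrict_of_subset_box Q hn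
  have hmap : (t • (refMeasure d Q).restrict (box d M m))
      = (t • (refMeasure d Q).restrict (shift x ⁻¹' box d M m)).map (shift x) := by
    rw [Measure.map_smul, ((measurePreserving_shift Q x).restrict_preimage
      (measurableSet_box m)).map_eq]
  rw [hmap, poissonExp_map _ (measurePreserving_shift Q x).measurable
    ((jMeasurable_clusterMean hφ.measurable).cMeasurable _)]
  simp only [clusterMean_map hφ.measurable (connection_shift hφ x)]
  exact poissonExp_le_meanCluster Q hφ t v hn

include hφ in
theorem meanCluster_translate (t : ℝ≥0) (x : Fin d → ℝ) (p : M) :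
    meanCluster Q φ hφ.symm t (x, p) = meanCluster Q φ hφ.symm t (0, p) := by
  refine le_antisymm ?_ ?_
  · simpa [shift] using meanCluster_shift_le Q hφ t x (0, p)
  · simpa [shift] using meanCluster_shift_le Q hφ t (-x) (x, p)

end Boxes

section PathBound

universe u

variable {d : ℕ} {M : Type u} [MeasurableSpace M] (Q : Measure M) [IsProbabilityMeasure Q]
  {φ : Pt d M → Pt d M → I}

/-! ### Integrals over induced paths -/

instance : SigmaFinite (refMeasure d Q) := by
  unfold refMeasure
  infer_instance

/-- The mean of the path expansion, with the Mecke formula applied at each step. -/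
noncomputable def expansionIntegral (φ : Pt d M → Pt d M → I) (t : ℝ≥0) (c : Pt d M → ℝ≥0∞) :
    ℕ → List (Pt d M) → Pt d M → ℝ≥0∞
  | 0, _, v => c v
  | k + 1, h, v =>
    1 + t * ∫⁻ x, stepWeight φ h v x * expansionIntegral φ t c k (v :: h) x ∂refMeasure d Q

/-- The integral of `c` over the end points of induced paths of a given length. -/
noncomputable def inducedIntegral (φ : Pt d M → Pt d M → I) (c : Pt d M → ℝ≥0∞) :
    ℕ → List (Pt d M) → Pt d M → ℝ≥0∞
  | 0, _, v => c v
  | k + 1, h, v => ∫⁻ x, stepWeight φ h v x * inducedIntegral φ c k (v :: h) x ∂refMeasure d Q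

theorem prob_le_one (a : I) : prob a ≤ 1 := ENNReal.ofReal_le_one.2 a.2.2

theorem stepWeight_le {X : Type*} (φ : X → X → I) (h : List X) (v x : X) :
    stepWeight φ h v x ≤ prob (φ v x) := by
  refine mul_le_of_le_one_right' ?_
  induction h with
  | nil => simp
  | cons y h ih =>
    rw [List.map_cons, List.prod_cons]
    exact mul_le_one' (prob_le_one _) ih

theorem stepWeight_ne_top {X : Type*} (φ : X → X → I) (h : List X) (v x : X) :
    stepWeight φ h v x ≠ ∞ :=
  ((stepWeight_le φ h v x).trans (prob_le_one _)).trans_lt ENNReal.one_lt_top |>.ne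

theorem measurable_of_mem_map_const {X α : Type*} [MeasurableSpace X] [MeasurableSpace α]
    (h : List X) : ∀ g ∈ h.map fun y => fun _ : α => y, Measurable g := by
  intro g hg
  obtain ⟨y, _, rfl⟩ := List.mem_map.1 hg
  exact measurable_const

theorem measurable_stepWeight_right {X : Type*} [MeasurableSpace X] {φ : X → X → I}
    (hφ : Measurable fun p : X × X => φ p.1 p.2) (h : List X) (v : X) :
    Measurable fun x => stepWeight φ h v x := by
  simpa [Function.comp_def] using measurable_stepWeight hφ (α := X)
    (h := h.map fun y => fun _ : X => y)
    (measurable_of_mem_map_const _) (v := fun _ => v) measurable_const measurable_id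

variable (hφ : IsConnectionFunction φ)

include hφ in
-- Each sum over points becomes an integral by the Mecke formula, and the box intensity is then
-- enlarged to tλ. The cluster left at the end of the path is bounded by the one in the whole space.
theorem poissonExp_pathExpansion_le (t : ℝ≥0) (m k : ℕ) (h : List (Pt d M)) (v : Pt d M) :
    poissonExp (t • (refMeasure d Q).restrict (box d M m)) (pathExpansion φ k h v)
      ≤ expansionIntegral Q φ t (meanCluster Q φ hφ.symm t) k h v := by
  induction k generalizing h v with
  | zero => exact poissonExp_le_meanCluster Q hφ t v subset_rfl
  | succ k ih =>
    have hJ : JMeasurable fun x r => stepWeight φ h v x * pathExpansion φ k (v :: h) x r := by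
      refine JMeasurable.mul_left ?_ (measurable_stepWeight_right hφ.measurable h v)
      simpa [Function.comp_def] using jMeasurable_pathExpansion hφ.measurable k (α := Pt d M)
        (h := (v :: h).map fun y => fun _ : Pt d M => y)
        (measurable_of_mem_map_const _) (v := id) measurable_id
    have h1 : pathExpansion φ (k + 1) h v = fun s => 1 + sumErase (fun x r =>
        stepWeight φ h v x * pathExpansion φ k (v :: h) x r) s := rfl
    rw [h1, poissonExp_fun_add _ (fun m => measurable_const), poissonExp_const,
      poissonExp_sumErase _ hJ, expansionIntegral]
    refine add_le_add_right ?_ 1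
    have h2 : (t • (refMeasure d Q).restrict (box d M m)) ≤ (t : ℝ≥0∞) • refMeasure d Q := by
      simpa using smul_restrict_mono Q le_rfl (Set.subset_univ (box d M m)) (t := t)
    refine (lintegral_mono' h2 fun x => ?_).trans (le_of_eq (lintegral_smul_measure _ _))
    rw [poissonExp_const_mul _ (stepWeight_ne_top φ h v x)]
    exact mul_le_mul_right (ih (v :: h) x) _

include hφ in
theorem meanCluster_le_expansionIntegral (t : ℝ≥0) (k : ℕ) (v : Pt d M) :
    meanCluster Q φ hφ.symm t v
      ≤ expansionIntegral Q φ t (meanCluster Q φ hφ.symm t) k [] v := by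
  conv_lhs => rw [meanCluster_eq_iSup Q hφ]
  exact iSup_le fun m => (poissonExp_mono _
    (clusterMean_le_pathExpansion hφ.measurable k v)).trans
    (poissonExp_pathExpansion_le Q hφ t m k [] v)

include hφ in
theorem lintegral_connection (v : Pt d M) :
    ∫⁻ x, prob (φ v x) ∂refMeasure d Q = ∫⁻ q, dφ φ v.2 q ∂Q := by
  obtain ⟨y, p⟩ := v
  have hm : Measurable fun x => prob (φ (y, p) x) :=
    measurable_prob.comp (hφ.measurable.comp measurable_prodMk_left)
  rw [refMeasure, lintegral_prod_symm _ hm.aemeasurable]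
  refine lintegral_congr fun q => ?_
  simp only [hφ.translation y]
  exact lintegral_sub_right_eq_self (fun x => prob (φ (0, p) (x, q))) y

/-- The geometric bound on the contribution of the paths that are shorter than `k`. -/
noncomputable def geometricBound (t : ℝ≥0) (C : ℝ≥0∞) : ℕ → ℝ≥0∞
  | 0 => 0
  | k + 1 => 1 + t * (geometricBound t C k * C)

theorem geometricBound_lt_top (t : ℝ≥0) {C : ℝ≥0∞} (hC : C < ∞) (k : ℕ) :
    geometricBound t C k < ∞ := by
  induction k with
  | zero => exact ENNReal.zero_lt_top
  | succ k ih =>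
    rw [geometricBound]
    finiteness

include hφ in
-- Separates the final term carrying c from the shorter paths. For the shorter ones the factors 1 -
-- φ are bounded by 1, so each further step costs at most tC.
theorem expansionIntegral_le (t : ℝ≥0) (c : Pt d M → ℝ≥0∞) {C : ℝ≥0∞}
    (hC : ∀ᵐ p ∂Q, ∫⁻ q, dφ φ p q ∂Q ≤ C) (k : ℕ) (h : List (Pt d M)) (v : Pt d M)
    (hv : ∫⁻ q, dφ φ v.2 q ∂Q ≤ C) :
    expansionIntegral Q φ t c k h v
      ≤ geometricBound t C k + (t : ℝ≥0∞) ^ k * inducedIntegral Q φ c k h v := by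
  -- The bound C holds for almost all marks only, which is enough for the next point of the path
  -- since that point is integrated against λ.
  have hC' : ∀ᵐ x ∂refMeasure d Q, ∫⁻ q, dφ φ x.2 q ∂Q ≤ C :=
    Measure.quasiMeasurePreserving_snd.ae hC
  induction k generalizing h v with
  | zero => simp [expansionIntegral, geometricBound, inducedIntegral]
  | succ k ih =>
    rw [expansionIntegral, geometricBound, inducedIntegral, add_assoc, pow_succ', mul_assoc,
      ← mul_add]
    refine add_le_add_right (mul_le_mul_right ?_ _) 1
    calc ∫⁻ x, stepWeight φ h v x * expansionIntegral Q φ t c k (v :: h) x ∂refMeasure d Q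
        ≤ ∫⁻ x, (geometricBound t C k * stepWeight φ h v x + (t : ℝ≥0∞) ^ k *
          (stepWeight φ h v x * inducedIntegral Q φ c k (v :: h) x)) ∂refMeasure d Q := by
          refine lintegral_mono_ae ?_
          filter_upwards [hC'] with x hx
          refine (mul_le_mul_right (ih (v :: h) x hx) _).trans (le_of_eq ?_)
          ring
      _ = geometricBound t C k * ∫⁻ x, stepWeight φ h v x ∂refMeasure d Q + (t : ℝ≥0∞) ^ k *
          ∫⁻ x, stepWeight φ h v x * inducedIntegral Q φ c k (v :: h) x ∂refMeasure d Q := by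
          have hm := measurable_stepWeight_right hφ.measurable h v
          rw [lintegral_add_left (hm.const_mul _), lintegral_const_mul _ hm,
            lintegral_const_mul' _ _ (by finiteness)]
      _ ≤ _ := by
          refine add_le_add_left (mul_le_mul_right ?_ _) _
          refine (lintegral_mono fun x => stepWeight_le φ h v x).trans ?_
          rw [lintegral_connection Q hφ]
          exact hv

/-! ### Induced paths and the kernel d_φ^{[n]} -/

/-- The probability that the points of `z` form an induced path when appended to `v` and `h`. -/
noncomputable def pathWeight {X : Type*} (φ : X → X → I) : (k : ℕ) → List X → X → (Fin k → X) → ℝ≥0∞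
  | 0, _, _, _ => 1
  | k + 1, h, v, z =>
    stepWeight φ h v (z 0) * pathWeight φ k (v :: h) (z 0) fun i => z i.succ

/-- The last point of the path with initial point `v` and further points `z`. -/
def lastPoint {X : Type*} : (k : ℕ) → X → (Fin k → X) → X
  | 0, v, _ => v
  | k + 1, _, z => lastPoint k (z 0) fun i => z i.succ

theorem lastPoint_succ {X : Type*} (k : ℕ) (v : X) (z : Fin (k + 1) → X) :
    lastPoint (k + 1) v z = z (Fin.last k) := by
  induction k generalizing v with
  | zero => rfl
  | succ k ih =>
    rw [lastPoint, ih]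
    rfl

theorem measurable_pathWeight {X : Type*} [MeasurableSpace X] {φ : X → X → I}
    (hφ : Measurable fun p : X × X => φ p.1 p.2) {α : Type*} [MeasurableSpace α] (k : ℕ)
    {h : List (α → X)} (hh : ∀ g ∈ h, Measurable g) {v : α → X} (hv : Measurable v)
    {z : α → Fin k → X} (hz : Measurable z) :
    Measurable fun a => pathWeight φ k (h.map fun g => g a) (v a) (z a) := by
  induction k generalizing h v with
  | zero => exact measurable_const
  | succ k ih =>
    have hz0 : Measurable fun a => z a 0 := (measurable_pi_apply 0).comp hz
    refine (measurable_stepWeight hφ hh hv hz0).mul ?_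
    exact ih (h := v :: h) (fun g hg => by
      rcases List.mem_cons.1 hg with rfl | hg
      exacts [hv, hh g hg]) hz0
      (measurable_pi_lambda _ fun i => (measurable_pi_apply i.succ).comp hz)

theorem measurable_lastPoint {X : Type*} [MeasurableSpace X] {α : Type*} [MeasurableSpace α]
    (k : ℕ) {v : α → X} (hv : Measurable v) {z : α → Fin k → X} (hz : Measurable z) :
    Measurable fun a => lastPoint k (v a) (z a) := by
  induction k generalizing v with
  | zero => exact hv
  | succ k ih =>
    exact ih ((measurable_pi_apply 0).comp hz)
      (measurable_pi_lambda _ fun i => (measurable_pi_apply i.succ).comp hz)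

theorem lintegral_pi_fin_succ {X : Type*} [MeasurableSpace X] (μ : Measure X) [SigmaFinite μ]
    {k : ℕ} (i : Fin (k + 1)) {f : (Fin (k + 1) → X) → ℝ≥0∞} (hf : Measurable f) :
    ∫⁻ z, f z ∂Measure.pi (fun _ : Fin (k + 1) => μ)
      = ∫⁻ x, ∫⁻ z, f (i.insertNth x z) ∂Measure.pi (fun _ : Fin k => μ) ∂μ := by
  have h := measurePreserving_piFinSuccAbove (fun _ : Fin (k + 1) => μ) i
  have hm : Measurable fun p : X × (Fin k → X) => f (i.insertNth p.1 p.2) :=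
    hf.comp (MeasurableEquiv.piFinSuccAbove (fun _ : Fin (k + 1) => X) i).symm.measurable
  rw [← lintegral_prod _ hm.aemeasurable, ← h.lintegral_comp hm]
  refine lintegral_congr fun z => ?_
  change f z = f (i.insertNth (z i) (i.removeNth z))
  rw [Fin.insertNth_self_removeNth]

include hφ in
theorem inducedIntegral_eq {c : Pt d M → ℝ≥0∞} (hc : Measurable c) (k : ℕ)
    (h : List (Pt d M)) (v : Pt d M) :
    inducedIntegral Q φ c k h v = ∫⁻ z, pathWeight φ k h v z * c (lastPoint k v z)
      ∂Measure.pi (fun _ : Fin k => refMeasure d Q) := by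
  induction k generalizing h v with
  | zero => simp [inducedIntegral, pathWeight, lastPoint]
  | succ k ih =>
    have hW : ∀ (k : ℕ) (h : List (Pt d M)) (v : Pt d M),
        Measurable fun z : Fin k → Pt d M => pathWeight φ k h v z * c (lastPoint k v z) := by
      intro k h v
      refine Measurable.mul ?_ (hc.comp (measurable_lastPoint k measurable_const measurable_id))
      simpa [Function.comp_def] using measurable_pathWeight hφ.measurable k
        (α := Fin k → Pt d M) (h := h.map fun y => fun _ => y) (measurable_of_mem_map_const _)
        (v := fun _ => v) measurable_const measurable_id
    rw [lintegral_pi_fin_succ _ 0 (hW (k + 1) h v), inducedIntegral]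
    refine lintegral_congr fun x => ?_
    rw [ih, ← lintegral_const_mul _ (hW k _ _)]
    refine lintegral_congr fun z => ?_
    simp [pathWeight, lastPoint, mul_assoc]

theorem prod_map_reverse_range {α : Type*} [CommMonoid α] (f : ℕ → α) (l : ℕ) :
    ((List.range l).reverse.map f).prod = ∏ j ∈ Finset.range l, f j := by
  induction l with
  | zero => simp
  | succ l ih =>
    rw [List.range_succ, List.reverse_append, List.reverse_singleton, List.singleton_append,
      List.map_cons, List.prod_cons, ih, Finset.prod_range_succ, mul_comm]

/-- The history at time l lists the earlier points with the latest first, hence the reversed range;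
the induction moves l forward. -/
theorem pathWeight_eq {X : Type*} (φ : X → X → I) (y : ℕ → X) (k l : ℕ) :
    pathWeight φ k ((List.range l).reverse.map y) (y l) (fun i => y (l + 1 + i))
      = ∏ i ∈ Finset.range k, (prob (φ (y (l + i)) (y (l + i + 1))) *
        ∏ j ∈ Finset.range (l + i), prob (unitInterval.symm (φ (y j) (y (l + i + 1))))) := by
  induction k generalizing l with
  | zero => rfl
  | succ k ih =>
    rw [Finset.prod_range_succ', pathWeight, mul_comm]
    congr 1
    · have h1 : y l :: (List.range l).reverse.map y = (List.range (l + 1)).reverse.map y := by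
        simp [List.range_succ]
      have h2 : (fun i : Fin k => y (l + 1 + (i.succ : Fin (k + 1)))) =
          fun i : Fin k => y (l + 1 + 1 + i) := by
        ext1 i
        congr 1
        simp only [Fin.val_succ]
        omega
      rw [h1, h2]
      refine (ih (l + 1)).trans (Finset.prod_congr rfl fun i _ => ?_)
      rw [show l + 1 + i = l + (i + 1) by omega]
    · rw [stepWeight, List.map_map, prod_map_reverse_range]
      rfl

/-- Groups the non-adjacent pairs by their larger index, as in the exploration: a new point avoids
all earlier ones except its predecessor. -/
theorem prod_nonadjacent {α : Type*} [CommMonoid α] (g : ℕ → ℕ → α) (n : ℕ) :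
    ∏ i ∈ Finset.range (n + 1), ∏ j ∈ Finset.Icc (i + 2) n, g i j
      = ∏ i ∈ Finset.range n, ∏ j ∈ Finset.range i, g j (i + 1) := by
  -- The condition i + 2 ≤ j reads i < j - 1; truncated subtraction makes the product for j = 0
  -- empty.
  rw [Finset.prod_comm' (t' := Finset.range (n + 1)) (s' := fun j => Finset.range (j - 1)),
    Finset.prod_range_succ']
  · simp
  · intro i j
    simp only [Finset.mem_range, Finset.mem_Icc]
    omega

theorem lintegral_refMeasure_mul {Z : Type*} [MeasurableSpace Z] (ρ : Measure Z) [SFinite ρ]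
    {K : Pt d M × Z → ℝ≥0∞} (hK : Measurable K) {g : M → ℝ≥0∞} (hg : Measurable g) :
    ∫⁻ x, ∫⁻ z, K (x, z) * g x.2 ∂ρ ∂refMeasure d Q
      = ∫⁻ q, (∫⁻ x, ∫⁻ z, K ((x, q), z) ∂ρ) * g q ∂Q := by
  have h1 : Measurable fun x => ∫⁻ z, K (x, z) ∂ρ := hK.lintegral_prod_right'
  have h2 : ∀ x : Pt d M, ∫⁻ z, K (x, z) * g x.2 ∂ρ = (∫⁻ z, K (x, z) ∂ρ) * g x.2 :=
    fun x => lintegral_mul_const _ (hK.comp measurable_prodMk_left)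
  simp only [h2]
  refine (lintegral_prod_symm _ (h1.mul (hg.comp measurable_snd)).aemeasurable).trans ?_
  exact lintegral_congr fun q =>
    lintegral_mul_const (g q) (h1.comp (measurable_prodMk_right (y := q)))

omit [MeasurableSpace M] in
theorem pathWeight_insertNth_last (φ : Pt d M → Pt d M → I) (m : ℕ) (p q : M) (x : Fin d → ℝ)
    (z : Fin m → Pt d M) :
    pathWeight φ (m + 1) [] (0, p) ((Fin.last m).insertNth (x, q) z : Fin (m + 1) → Pt d M)
      = (∏ i ∈ Finset.range (m + 1),
          prob (φ (pathPoint (m + 1) p q x z i) (pathPoint (m + 1) p q x z (i + 1)))) *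
        ∏ i ∈ Finset.range (m + 1 + 1), ∏ j ∈ Finset.Icc (i + 2) (m + 1),
          prob (unitInterval.symm
            (φ (pathPoint (m + 1) p q x z i) (pathPoint (m + 1) p q x z j))) := by
  have hy : ((Fin.last m).insertNth (x, q) z : Fin (m + 1) → Pt d M)
      = fun i : Fin (m + 1) => pathPoint (m + 1) p q x z (0 + 1 + i) := by
    ext1 i
    refine Fin.lastCases ?_ (fun i => ?_) i
    · simp [pathPoint]
    · simp [pathPoint]
  rw [hy]
  refine (pathWeight_eq φ (pathPoint (m + 1) p q x z) (m + 1) 0).trans ?_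
  rw [prod_nonadjacent, ← Finset.prod_mul_distrib]
  simp only [zero_add]

include hφ in
-- The last of the n points is split off and its mark integrated outermost. As g sees only this
-- mark, the integral over everything else is d_φ^{[n]}.
theorem inducedIntegral_eq_dBracket {g : M → ℝ≥0∞} (hg : Measurable g) {n : ℕ} (hn : 1 ≤ n)
    (p : M) :
    inducedIntegral Q φ (fun v => g v.2) n [] (0, p) = ∫⁻ q, dBracket Q φ n p q * g q ∂Q := by
  obtain ⟨m, rfl⟩ : ∃ m, n = m + 1 := ⟨n - 1, by omega⟩
  have hW : Measurable fun z : Fin (m + 1) → Pt d M => pathWeight φ (m + 1) [] (0, p) z :=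
    measurable_pathWeight hφ.measurable (m + 1) (α := Fin (m + 1) → Pt d M) (h := [])
      (by simp) (v := fun _ => (0, p)) measurable_const measurable_id
  have hins : Measurable fun a : Pt d M × (Fin m → Pt d M) =>
      pathWeight φ (m + 1) [] (0, p) ((Fin.last m).insertNth a.1 a.2 : Fin (m + 1) → Pt d M) :=
    hW.comp (MeasurableEquiv.piFinSuccAbove (fun _ : Fin (m + 1) => Pt d M)
      (Fin.last m)).symm.measurable
  have hWg : Measurable fun z : Fin (m + 1) → Pt d M =>
      pathWeight φ (m + 1) [] (0, p) z * g (lastPoint (m + 1) (0, p) z).2 :=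
    hW.mul (hg.comp (measurable_snd.comp
      (measurable_lastPoint (m + 1) measurable_const measurable_id)))
  rw [inducedIntegral_eq Q hφ (c := fun v => g v.2) (hg.comp measurable_snd),
    lintegral_pi_fin_succ _ (Fin.last m) hWg]
  simp only [lastPoint_succ, Fin.insertNth_apply_same]
  refine (lintegral_refMeasure_mul Q _ hins hg).trans ?_
  simp only [pathWeight_insertNth_last]
  rfl

/-! ### Comparison of norms and critical intensities -/

include hφ in
/-- The mean cluster size is essentially bounded by its `L¹`-norm. -/
theorem ae_meanCluster_le (t : ℝ≥0) {n : ℕ} (hn : 1 ≤ n) :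
    ∀ᵐ p ∂Q, meanCluster Q φ hφ.symm t (0, p) ≤
      geometricBound t (normInftyOne Q (dφ φ)) n + (t : ℝ≥0∞) ^ n *
        (normInftyInfty Q (dBracket Q φ n) * ∫⁻ q, meanCluster Q φ hφ.symm t (0, q) ∂Q) := by
  have h1 : ∀ᵐ p ∂Q, ∫⁻ q, dφ φ p q ∂Q ≤ normInftyOne Q (dφ φ) := ENNReal.ae_le_essSup _
  have h2 : ∀ᵐ p ∂Q, ∀ᵐ q ∂Q, dBracket Q φ n p q ≤ normInftyInfty Q (dBracket Q φ n) :=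
    Measure.ae_ae_of_ae_prod (ENNReal.ae_le_essSup fun z : M × M => dBracket Q φ n z.1 z.2)
  have hc : meanCluster Q φ hφ.symm t = fun v => meanCluster Q φ hφ.symm t (0, v.2) :=
    funext fun v => meanCluster_translate Q hφ t v.1 v.2
  have hg : Measurable fun q : M => meanCluster Q φ hφ.symm t (0, q) :=
    (measurable_meanCluster Q hφ t).comp measurable_prodMk_left
  filter_upwards [h1, h2] with p hp hp'
  refine (meanCluster_le_expansionIntegral Q hφ t n (0, p)).trans
    ((expansionIntegral_le Q hφ t _ h1 n [] (0, p) hp).trans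
      (add_le_add_right (mul_le_mul_right ?_ _) _))
  -- By translation invariance c is a function of the mark, so the final term is an integral of c
  -- against d_φ^{[n]}(p,·), whose essential supremum can be pulled out.
  rw [hc, inducedIntegral_eq_dBracket Q hφ hg hn p, ← lintegral_const_mul _ hg]
  refine lintegral_mono_ae ?_
  filter_upwards [hp'] with q hq
  exact mul_le_mul_left hq _

include hφ in
-- The chain L¹ ≤ L^r ≤ L^∞ on a probability space is closed into a circle by `ae_meanCluster_le`.
theorem essSup_meanCluster_lt_top_iff {n : ℕ} (hn : 1 ≤ n)
    (hfin : normInftyOne Q (dφ φ) + normInftyInfty Q (dBracket Q φ n) < ∞) {r : ℝ≥0∞}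
    (hr : 1 ≤ r) (t : ℝ≥0) :
    essSup (fun v => meanCluster Q φ hφ.symm t v) (refMeasure d Q) < ∞ ↔
      eLpNorm (fun p : M => meanCluster Q φ hφ.symm t ((0, p) : Pt d M)) r Q ≠ ∞ := by
  have hg : Measurable fun q : M => meanCluster Q φ hφ.symm t (0, q) :=
    (measurable_meanCluster Q hφ t).comp measurable_prodMk_left
  have hs : AEStronglyMeasurable (fun q : M => meanCluster Q φ hφ.symm t (0, q)) Q :=
    hg.aestronglyMeasurable
  constructor
  · intro h
    have h1 := Measure.ae_ae_of_ae_prod (μ := (volume : Measure (Fin d → ℝ))) (ν := Q)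
      (ENNReal.ae_le_essSup (μ := refMeasure d Q) fun v => meanCluster Q φ hφ.symm t v)
    -- Some location x is good for almost every mark; translation invariance moves it to the origin.
    obtain ⟨x, hx⟩ := h1.exists
    have h2 : essSup (fun p : M => meanCluster Q φ hφ.symm t ((0, p) : Pt d M)) Q ≤
        essSup (fun v => meanCluster Q φ hφ.symm t v) (refMeasure d Q) := by
      refine essSup_le_of_ae_le _ ?_
      filter_upwards [hx] with p hp
      rwa [meanCluster_translate Q hφ t x p] at hp
    refine ((eLpNorm_le_eLpNorm_of_exponent_le le_top hs).trans_lt ?_).ne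
    rw [eLpNorm_exponent_top, eLpNormEssSup]
    simp only [enorm_eq_self]
    exact h2.trans_lt h
  · intro h
    have h1 : ∫⁻ q, meanCluster Q φ hφ.symm t (0, q) ∂Q < ∞ := by
      have := (eLpNorm_le_eLpNorm_of_exponent_le hr hs).trans_lt (lt_top_iff_ne_top.2 h)
      simpa only [eLpNorm_one_eq_lintegral_enorm, enorm_eq_self] using this
    have h2 : ∀ᵐ v ∂refMeasure d Q, meanCluster Q φ hφ.symm t (0, v.2) ≤ _ :=
      Measure.quasiMeasurePreserving_snd.ae (ae_meanCluster_le Q hφ t hn)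
    refine (essSup_le_of_ae_le (geometricBound t (normInftyOne Q (dφ φ)) n + (t : ℝ≥0∞) ^ n *
        (normInftyInfty Q (dBracket Q φ n) * ∫⁻ q, meanCluster Q φ hφ.symm t (0, q) ∂Q))
        ?_).trans_lt ?_
    · filter_upwards [h2] with v hv
      rwa [← meanCluster_translate Q hφ t v.1 v.2] at hv
    · obtain ⟨ha, hb⟩ := ENNReal.add_lt_top.1 hfin
      have := geometricBound_lt_top t ha n
      finiteness

/-- The supremum of a down-closed set of intensities is the infimum of its complement. -/
theorem sSup_eq_sInf_compl {P : ℝ≥0 → Prop} (hP : ∀ s t, s ≤ t → P t → P s) :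
    sSup {s : ℝ≥0∞ | ∃ t : ℝ≥0, s = t ∧ P t} = sInf {s : ℝ≥0∞ | ∃ t : ℝ≥0, s = t ∧ ¬ P t} := by
  refine le_antisymm (sSup_le ?_) (le_of_not_gt fun hlt => ?_)
  · rintro _ ⟨t, rfl, ht⟩
    refine le_sInf ?_
    rintro _ ⟨s, rfl, hs⟩
    exact ENNReal.coe_le_coe.2 (le_of_not_ge fun hst => hs (hP s t hst ht))
  · obtain ⟨u, h1, h2⟩ := ENNReal.lt_iff_exists_nnreal_btwn.1 hlt
    by_cases hu : P u
    · exact h1.not_ge (le_sSup ⟨u, rfl, hu⟩)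
    · exact h2.not_ge (sInf_le ⟨u, rfl, hu⟩)

end PathBound

end MarkedRCM

theorem proposition7 {d : ℕ} (hd : 0 < d)
    {M : Type*} [MetricSpace M] [CompleteSpace M] [TopologicalSpace.SeparableSpace M]
    [MeasurableSpace M] [BorelSpace M]
    (Q : MeasureTheory.Measure M) [MeasureTheory.IsProbabilityMeasure Q]
    (φ : MarkedRCM.Pt d M → MarkedRCM.Pt d M → unitInterval)
    (hφ : MarkedRCM.IsConnectionFunction φ)
    (n : ℕ) (hn : 1 ≤ n)
    (hmain : MarkedRCM.normInftyOne Q (MarkedRCM.dφ φ) +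
      MarkedRCM.normInftyInfty Q (MarkedRCM.dBracket Q φ n) < ⊤)
    (r : ENNReal) (hr : 1 ≤ r) :
    MarkedRCM.tT Q φ hφ.symm = MarkedRCM.tTr Q φ hφ.symm r := by
  have h := MarkedRCM.essSup_meanCluster_lt_top_iff Q hφ hn hmain hr
  have hP : ∀ s t : ℝ≥0, s ≤ t →
      essSup (fun v => MarkedRCM.meanCluster Q φ hφ.symm t v) (MarkedRCM.refMeasure d Q) < ∞ →
      essSup (fun v => MarkedRCM.meanCluster Q φ hφ.symm s v) (MarkedRCM.refMeasure d Q) < ∞ :=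
    fun s t hst ht => (essSup_mono_ae (Filter.Eventually.of_forall fun v =>
      MarkedRCM.meanCluster_mono Q hφ hst v)).trans_lt ht
  rw [MarkedRCM.tT, MarkedRCM.tTr, MarkedRCM.sSup_eq_sInf_compl hP]
  simp only [h, not_not]
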